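/- **Setting.** Let $X\subseteq\mathbb{R}^n$ be a Borel set, $W\subset\mathbb{R}^d$ compact, $U$ a nonempty finite set of actions, and $\mathrm{AP}$ a finite set of atomic propositions. Consider $x_{t+1}=f(x_t,u_t,w_t)$ with $f:X\times U\times W\to X$ and $(w_t)$ i.i.d. with law $P_W$ on $W$; its transition kernel is $\mathcal{T}(D\mid x,u)=P_W\{w: f(x,u,w)\in D\}$. Let $X_{\rm safe}\subseteq X$, let $R$ be a finite partition of $X$ into Borel regions of interest, one of which is $X\setminus X_{\rm safe}$ (possibly empty), and let $L:X\to 2^{\mathrm{AP}}$ be constant on each region, with a proposition $\mathfrak{p}_{\rm safe}$ such that $\mathfrak{p}_{\rm safe}\in L(x)$ iff $x\in X_{\rm safe}$. Assume: 1. $X_{\rm safe}$ is compact, and the boundary (in $X$) of each $r\in R$ has Lebesgue measure zero; 2. each $\mathcal{T}(\cdot\mid x,u)$ has a density $\tau(\cdot\mid x,u)$ with respect to Lebesgue measure on $X$, and $\sup_{x,x',u}\tau(x'\mid x,u)<\infty$; 3. there is $L_f\ge0$ with $\|f(x,u,w)-f(x',u,w')\|\le L_f(\|x-x'\|+\|w-w'\|)$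 for all $x,x',w,w',u$. For a formula $\varphi$ of linear temporal logic over finite traces (LTL$_f$), a finite trajectory satisfies $\varphi$ if some nonempty prefix of its trace of labels does. For a horizon $T\in\mathbb{N}_0$ and a measurable, history-dependent controller $\kappa=(\kappa_0,\dots,\kappa_{T-1})$, let $\Pr^\kappa_{x_0}[\varphi,T]$ be the probability that the closed-loop trajectory $x_0,\dots,x_T$ satisfies $\varphi$, and let $\Pr^*_{x_0}[\varphi,T]=\sup_\kappa\Pr^\kappa_{x_0}[\varphi,T]$. **Abstractions.** Let $X_{\rm abs}=X_{\rm safe}\cup f(X_{\rm safe},U,W)$. A UMDP abstraction consists of: a finite Borel partition of $X_{\rm abs}$, each cell being contained in, or disjoint from, each $r\in R$; for each cell a representative point of it at positive distance from its boundary, the set of representatives being $S$, with $\rho:X_{\rm abs}\to S$ mapping a state to the representative of its cell; a finite Borel partition of $W$; and closed sets $\Gamma_{s,a}\subseteq\mathcal{P}(S)$ for $s\in S$, $a\in U$. The size of the partition of $X_{\rm abs}$ is half the largest diameter of a cell. The abstraction is sound if, for all $a\in U$, (i) for all $x\in X_{\rm safe}$ the distribution $s'\mapsto\mathcal{T}(\rho^{-1}(s')\mid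 x,a)$ belongs to $\Gamma_{\rho(x),a}$, and (ii) $\Gamma_{\rho(x),a}=\{\delta_{\rho(x)}\}$ for all $x\in X_{\rm abs}\setminus X_{\rm safe}$. Its ambiguity diameter $\phi$ is the largest diameter of $\Gamma_{s,a}$ in the $1$-Wasserstein distance over $s\in S\cap X_{\rm safe}$ and $a\in U$. An abstraction procedure gives, for each $\eta>0$, a sound UMDP abstraction $\mathcal{U}^\eta$ whose partition of $X_{\rm abs}$ has size at most $\eta$ and whose partition of $W$ has cells of diameter at most $2\eta$. **Robust dynamic programming (RDP).** Let $\varphi=\square\mathfrak{p}_{\rm safe}\wedge\varphi'$ and let $\mathcal{A}=(Z,z_{\rm init},2^{\mathrm{AP}},\delta,Z_{\rm acc})$ be a finite deterministic automaton that accepts a nonempty trace iff the trace satisfies $\varphi$. For $v:X\times Z\to[0,1]$, let $v^\eta(x,z)=\inf\{v(y,z): y\in X_{\rm abs},\ \rho^\eta(y)=\rho^\eta(x)\}$ for $x\in X_{\rm abs}$, and $v^\eta(x,z)=0$ elsewhere. For $s\in S^\eta$ let $\underline{\mathcal B}^\eta_a[v](s,z)=1$ if $z\in Z_{\rm acc}$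 and $$\underline{\mathcal B}^\eta_a[v](s,z)=\min_{\gamma\in\Gamma^\eta_{s,a}}\sum_{s'\in S^\eta}\gamma(s')\,v^\eta(s',\delta(z,L(s')))$$ otherwise; let $\underline{\mathcal B}^\eta[v](x,z)=\max_{a}\underline{\mathcal B}^\eta_a[v](\rho^\eta(x),z)$ for $x\in X_{\rm safe}$ and $0$ for $x\notin X_{\rm safe}$. Define $\overline{\mathcal B}^\eta_a$ and $\overline{\mathcal B}^\eta$ in the same way, with $\max_\gamma$ in place of $\min_\gamma$. Put $\underline v_0=\overline v_0=\mathbf 1_{X\times Z_{\rm acc}}$, $\underline v_{k+1}=\underline{\mathcal B}^\eta[\underline v_k]$, $\overline v_{k+1}=\overline{\mathcal B}^\eta[\overline v_k]$, and $\underline p^\eta_T(x)=\underline v_T(x,\delta(z_{\rm init},L(x)))$, $\overline p^\eta_T(x)=\overline v_T(x,\delta(z_{\rm init},L(x)))$. Choose any $\sigma^\eta_t(s,z)\in\arg\max_a\underline{\mathcal B}^\eta_a[\underline v_{T-t-1}](s,z)$ for $t<T$. The synthesized controller $\kappa^\eta$ applies, after $x_0,\dots,x_t$ with $x_t\in X_{\rm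 abs}$, the action $\sigma^\eta_t(\rho^\eta(x_t),z)$, where $z$ is the state of $\mathcal{A}$ after reading $L(x_0)\cdots L(x_t)$; if $x_t\notin X_{\rm abs}$ it applies an arbitrary fixed action. **Theorem (Asymptotic Optimality).** Under assumptions 1–3, if $\lim_{\eta\to0}\phi(\mathcal{U}^\eta)=0$, then the abstraction procedure is asymptotically optimal: for every LTL$_f$ formula $\varphi'$ and every horizon $T\in\mathbb{N}_0$, with $\varphi=\square\mathfrak{p}_{\rm safe}\wedge\varphi'$, for every automaton $\mathcal{A}$ as above and every choice of maximizers $\sigma^\eta$, the functions $x_0\mapsto\Pr^{\kappa^\eta}_{x_0}[\varphi,T]$, $\underline p^\eta_T$ and $\overline p^\eta_T$ converge to $x_0\mapsto\Pr^*_{x_0}[\varphi,T]$, uniformly on $X$, as $\eta\to0$. -/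

import Mathlib

open MeasureTheory Filter Topology
open scoped ENNReal NNReal

noncomputable section

/-! ## Linear temporal logic over finite traces -/

/-- LTL formulas over finite traces, with atomic propositions in `AP`. -/
inductive LTLf (AP : Type*) where
  | top : LTLf AP
  | atom (p : AP) : LTLf AP
  | neg (φ : LTLf AP) : LTLf AP
  | and (φ ψ : LTLf AP) : LTLf AP
  | next (φ : LTLf AP) : LTLf AP
  | untl (φ ψ : LTLf AP) : LTLf AP

namespace LTLf

variable {AP : Type*}

/-- `φ` holds at position `i` of the finite trace `l`. -/
def Sat : LTLf AP → List (Set AP) → ℕ → Prop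
  | top, _, _ => True
  | atom p, l, i => ∃ h : i < l.length, p ∈ l[i]
  | neg φ, l, i => ¬ Sat φ l i
  | and φ ψ, l, i => Sat φ l i ∧ Sat ψ l i
  | next φ, l, i => i + 1 < l.length ∧ Sat φ l (i + 1)
  | untl φ ψ, l, i =>
      ∃ j, i ≤ j ∧ j < l.length ∧ Sat ψ l j ∧ ∀ k, i ≤ k → k < j → Sat φ l k

/-- The finite trace `l` satisfies `φ`. -/
def Models (l : List (Set AP)) (φ : LTLf AP) : Prop := Sat φ l 0

/-- `◇ φ`. -/
def eventually (φ : LTLf AP) : LTLf AP := untl top φ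

/-- `□ φ`. -/
def globally (φ : LTLf AP) : LTLf AP := neg (eventually (neg φ))

/-- The automaton `A` over the alphabet `2^AP` accepts exactly the (nonempty) traces
that satisfy `φ`. -/
def RecognizedBy {Z : Type*} (φ : LTLf AP) (A : DFA (Set AP) Z) : Prop :=
  ∀ l : List (Set AP), l ≠ [] → (l ∈ A.accepts ↔ Models l φ)

end LTLf

/-! ## Wasserstein distance -/

/-- The (1-)Wasserstein distance: infimum of the transport cost over all couplings. -/
def wasserstein {E : Type*} [MeasurableSpace E] [PseudoEMetricSpace E] (μ ν : Measure E) : ℝ≥0∞ :=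
  ⨅ π : {π : Measure (E × E) // π.map Prod.fst = μ ∧ π.map Prod.snd = ν},
    ∫⁻ p, edist p.1 p.2 ∂π.1

/-! ## The controlled stochastic system -/

/-- The system `x_{t+1} = f (x_t, u_t, w_t)` with state space `X ⊆ ℝⁿ`, finite action set `U`,
i.i.d. disturbances of law `PW` on the compact set `W ⊆ ℝᵈ`, regions of interest `R`, safe set
`Xsafe` and labelling function `L`. Sets of states are subsets of the subspace `X`. -/
structure ControlSystem {n d : ℕ} (X : Set (EuclideanSpace ℝ (Fin n)))
    (W : Set (EuclideanSpace ℝ (Fin d))) (U AP : Type*) where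
  measurableSet_X : MeasurableSet X
  isCompact_W : IsCompact W
  f : X → U → W → X
  PW : ProbabilityMeasure W
  Xsafe : Set X
  /-- the regions of interest, a finite partition of `X` containing the unsafe set
  (which may be empty) -/
  R : Finset (Set X)
  compl_safe_mem : Xsafeᶜ ∈ R
  measurableSet_region : ∀ r ∈ R, MeasurableSet r
  disjoint_regions : (R : Set (Set X)).PairwiseDisjoint id
  cover_regions : ⋃₀ (R : Set (Set X)) = Set.univ
  L : X → Set AP
  label_const : ∀ r ∈ R, ∀ x ∈ r, ∀ y ∈ r, L x = L y
  psafe : AP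
  psafe_mem : ∀ x, psafe ∈ L x ↔ x ∈ Xsafe

/-- Finite trajectories `x_0 →[u_0] ⋯ →[u_{t-1}] x_t` of length `t`. -/
abbrev Trajectory (S U : Type*) (t : ℕ) := (Fin (t + 1) → S) × (Fin t → U)

namespace ControlSystem

variable {n d : ℕ} {X : Set (EuclideanSpace ℝ (Fin n))} {W : Set (EuclideanSpace ℝ (Fin d))}
  {U AP : Type*}

/-- The transition kernel `𝒯(· ∣ x, u)`, the law of `f (x, u, w)` for `w ∼ PW`. -/
def kernel (sys : ControlSystem X W U AP) (x : X) (u : U) : Measure X :=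
  (sys.PW : Measure W).map (sys.f x u)

/-- Lebesgue measure on the state space `X`. -/
def lebesgue (_sys : ControlSystem X W U AP) : Measure X :=
  (volume : Measure (EuclideanSpace ℝ (Fin n))).comap Subtype.val

/-- The safe set is compact, and the boundaries (in `X`) of the regions of interest are
Lebesgue-null. -/
def CompactSafeNullBoundary (sys : ControlSystem X W U AP) : Prop :=
  IsCompact sys.Xsafe ∧ ∀ r ∈ sys.R, sys.lebesgue (frontier r) = 0

/-- The transition kernel has a bounded density with respect to Lebesgue measure. -/
def BoundedDensity (sys : ControlSystem X W U AP) : Prop :=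
  ∃ τ : X → U → X → ℝ≥0, (∀ x u, Measurable (τ x u)) ∧
    (∀ x u, sys.kernel x u = sys.lebesgue.withDensity (fun x' => (τ x u x' : ℝ≥0∞))) ∧
    ∃ M : ℝ≥0, ∀ x u x', τ x u x' ≤ M

/-- `f` is globally Lipschitz in the state and the disturbance, uniformly in the action. -/
def LipschitzDynamics (sys : ControlSystem X W U AP) : Prop :=
  ∃ Lf : ℝ, 0 ≤ Lf ∧ ∀ (x x' : X) (w w' : W) (u : U),
    dist (sys.f x u w) (sys.f x' u w') ≤ Lf * (dist x x' + dist w w')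

/-- The safe set together with all its possible one-step successors. -/
def Xabs (sys : ControlSystem X W U AP) : Set X :=
  sys.Xsafe ∪ {y | ∃ x ∈ sys.Xsafe, ∃ (u : U) (w : W), sys.f x u w = y}

theorem safe_subset_abs (sys : ControlSystem X W U AP) : sys.Xsafe ⊆ sys.Xabs :=
  Set.subset_union_left

/-- The trace of labels of a trajectory. -/
def trace (sys : ControlSystem X W U AP) {t : ℕ} (ω : Trajectory X U t) : List (Set AP) :=
  List.ofFn (fun i => sys.L (ω.1 i))

/-- A trajectory satisfies `φ` if some (nonempty) prefix of its trace does. -/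
def Satisfies (sys : ControlSystem X W U AP) {t : ℕ} (ω : Trajectory X U t) (φ : LTLf AP) : Prop :=
  ∃ k ≤ t, LTLf.Models ((sys.trace ω).take (k + 1)) φ

section Controllers

variable [MeasurableSpace U]

/-- Time-varying, history-dependent (measurable) controllers for horizon `T`. -/
structure Controller (_sys : ControlSystem X W U AP) (T : ℕ) where
  act : (t : Fin T) → Trajectory X U t → U
  measurable_act : ∀ t, Measurable (act t)

/-- The first `t` steps of the closed-loop trajectory from `x₀` under the controller `κ` and the
disturbance sequence `w`. -/
def closedLoop (sys : ControlSystem X W U AP) {T : ℕ} (κ : sys.Controller T) (x₀ : X)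
    (w : Fin T → W) : (t : ℕ) → t ≤ T → Trajectory X U t
  | 0, _ => (fun _ => x₀, Fin.elim0)
  | t + 1, h =>
      let ω := closedLoop sys κ x₀ w t (Nat.le_of_succ_le h)
      let u := κ.act ⟨t, h⟩ ω
      (Fin.snoc (α := fun _ => X) ω.1 (sys.f (ω.1 (Fin.last t)) u (w ⟨t, h⟩)),
        Fin.snoc (α := fun _ => U) ω.2 u)

/-- The law of the trajectory of length `T` from `x₀` under `κ`, the disturbances being
i.i.d. with law `PW`. -/
def trajMeasure (sys : ControlSystem X W U AP) {T : ℕ} (κ : sys.Controller T) (x₀ : X) :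
    Measure (Trajectory X U T) :=
  (Measure.pi (fun _ : Fin T => (sys.PW : Measure W))).map
    (fun w => sys.closedLoop κ x₀ w T le_rfl)

/-- The probability that the trajectory from `x₀` under `κ` satisfies `φ` within the horizon. -/
def prob (sys : ControlSystem X W U AP) {T : ℕ} (κ : sys.Controller T) (φ : LTLf AP) (x₀ : X) : ℝ :=
  (sys.trajMeasure κ x₀).real {ω | sys.Satisfies ω φ}

/-- The optimal satisfaction probability, the supremum over all controllers. -/
def optProb (sys : ControlSystem X W U AP) (T : ℕ) (φ : LTLf AP) (x₀ : X) : ℝ :=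
  ⨆ κ : sys.Controller T, sys.prob κ φ x₀

end Controllers

/-! ## Partitions and UMDP abstractions -/

/-- A finite measurable partition of `Xabs` that respects the regions of interest, given by its
set `S` of representative points and the map `ρ` sending a state to the representative of its
cell. Each representative has positive distance to the boundary of its cell. -/
structure StatePartition (sys : ControlSystem X W U AP) where
  S : Finset X
  S_subset : ∀ s ∈ S, s ∈ sys.Xabs
  ρ : sys.Xabs → S
  ρ_rep : ∀ s : S, ρ ⟨s, S_subset s s.2⟩ = s
  measurableSet_cell : ∀ s : S, MeasurableSet (Subtype.val '' (ρ ⁻¹' {s}) : Set X)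
  respects : ∀ s : S, ∀ r ∈ sys.R, (Subtype.val '' (ρ ⁻¹' {s}) : Set X) ⊆ r ∨
    (Subtype.val '' (ρ ⁻¹' {s}) : Set X) ⊆ rᶜ
  rep_interior : ∀ s : S,
    0 < Metric.infEDist (s : X) (frontier (Subtype.val '' (ρ ⁻¹' {s}) : Set X))

namespace StatePartition

variable {sys : ControlSystem X W U AP}

/-- The cell represented by `s`. -/
def cell (P : StatePartition sys) (s : P.S) : Set X := Subtype.val '' (P.ρ ⁻¹' {s})

/-- The size of the partition, half the largest diameter of a cell. -/
def size (P : StatePartition sys) : ℝ≥0∞ := (⨆ s : P.S, Metric.ediam (P.cell s)) / 2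

end StatePartition

/-- A UMDP abstraction: an `R`-respecting partition of `Xabs`, a finite partition `C` of the
disturbance set, and for each representative `s` and action `a` a closed set `Γ s a` of probability
vectors on `S`. Its actions and labels are those of the system. -/
structure UMDP (sys : ControlSystem X W U AP) extends StatePartition sys where
  C : Finset (Set W)
  measurableSet_C : ∀ c ∈ C, MeasurableSet c
  disjoint_C : (C : Set (Set W)).PairwiseDisjoint id
  cover_C : ⋃₀ (C : Set (Set W)) = Set.univ
  Γ : S → U → Set (S → ℝ)
  Γ_subset : ∀ s a, Γ s a ⊆ stdSimplex ℝ S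
  isClosed_Γ : ∀ s a, IsClosed (Γ s a)

namespace UMDP

variable {sys : ControlSystem X W U AP}

/-- A probability vector on `S`, seen as a measure on `X`. -/
def toMeasure (M : UMDP sys) (γ : M.S → ℝ) : Measure X :=
  ∑ s : M.S, ENNReal.ofReal (γ s) • Measure.dirac (s : X)

/-- The ambiguity diameter: the largest Wasserstein diameter of an ambiguity set of a safe
representative. -/
def ambiguityDiameter (M : UMDP sys) : ℝ≥0∞ :=
  ⨆ (s : M.S) (_ : (s : X) ∈ sys.Xsafe) (a : U) (γ ∈ M.Γ s a) (γ' ∈ M.Γ s a),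
    wasserstein (M.toMeasure γ) (M.toMeasure γ')

/-- Soundness: the discretized kernel of each safe state belongs to the ambiguity set of its
representative, and unsafe representatives are absorbing. -/
def IsSound (M : UMDP sys) : Prop :=
  (∀ (x : X) (hx : x ∈ sys.Xsafe) (a : U),
    (fun s' : M.S => (sys.kernel x a).real (M.cell s')) ∈
      M.Γ (M.ρ ⟨x, sys.safe_subset_abs hx⟩) a) ∧
  (∀ x : sys.Xabs, (x : X) ∉ sys.Xsafe → ∀ a : U, M.Γ (M.ρ x) a = {Pi.single (M.ρ x) 1})

/-! ### Robust dynamic programming on the product with an automaton -/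

section RDP

variable {Z : Type*}

open Classical in
/-- The tightest piecewise constant minorizer of `v` on the partition; `0` outside `Xabs`. -/
def minorizer (M : UMDP sys) (v : X → Z → ℝ) (x : X) (z : Z) : ℝ :=
  if h : x ∈ sys.Xabs then ⨅ y : {y : sys.Xabs // M.ρ y = M.ρ ⟨x, h⟩}, v y.1 z else 0

/-- Expectation under `γ` of the minorizer of `v` at the successor product state. -/
def expect (M : UMDP sys) (A : DFA (Set AP) Z) (v : X → Z → ℝ) (z : Z) (γ : M.S → ℝ) : ℝ :=
  ∑ s' : M.S, γ s' * M.minorizer v s' (A.step z (sys.L s'))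

open Classical in
/-- The pessimistic Bellman operator for a fixed action. For a sound abstraction the ambiguity
sets are compact and nonempty, so that the infimum is a minimum. -/
def pessAct (M : UMDP sys) (A : DFA (Set AP) Z) (v : X → Z → ℝ) (a : U) (s : M.S) (z : Z) : ℝ :=
  if z ∈ A.accept then 1 else sInf (M.expect A v z '' M.Γ s a)

open Classical in
/-- The optimistic Bellman operator for a fixed action. -/
def optAct (M : UMDP sys) (A : DFA (Set AP) Z) (v : X → Z → ℝ) (a : U) (s : M.S) (z : Z) : ℝ :=
  if z ∈ A.accept then 1 else sSup (M.expect A v z '' M.Γ s a)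

open Classical in
/-- The pessimistic Bellman operator. -/
def pess (M : UMDP sys) (A : DFA (Set AP) Z) (v : X → Z → ℝ) (x : X) (z : Z) : ℝ :=
  if h : x ∈ sys.Xsafe then ⨆ a : U, M.pessAct A v a (M.ρ ⟨x, sys.safe_subset_abs h⟩) z else 0

open Classical in
/-- The optimistic Bellman operator. -/
def opt (M : UMDP sys) (A : DFA (Set AP) Z) (v : X → Z → ℝ) (x : X) (z : Z) : ℝ :=
  if h : x ∈ sys.Xsafe then ⨆ a : U, M.optAct A v a (M.ρ ⟨x, sys.safe_subset_abs h⟩) z else 0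

/-- The initial value function, the indicator of the accepting product states. -/
def value₀ (A : DFA (Set AP) Z) : X → Z → ℝ := fun _ z => A.accept.indicator (fun _ => 1) z

/-- The pessimistic value functions. -/
def pessValue (M : UMDP sys) (A : DFA (Set AP) Z) (k : ℕ) : X → Z → ℝ :=
  (M.pess A)^[k] (value₀ A)

/-- The optimistic value functions. -/
def optValue (M : UMDP sys) (A : DFA (Set AP) Z) (k : ℕ) : X → Z → ℝ :=
  (M.opt A)^[k] (value₀ A)

/-- The lower bound on the satisfaction probability computed by RDP. -/
def lowerBound (M : UMDP sys) (A : DFA (Set AP) Z) (T : ℕ) (x₀ : X) : ℝ :=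
  M.pessValue A T x₀ (A.step A.start (sys.L x₀))

/-- The upper bound on the satisfaction probability computed by RDP. -/
def upperBound (M : UMDP sys) (A : DFA (Set AP) Z) (T : ℕ) (x₀ : X) : ℝ :=
  M.optValue A T x₀ (A.step A.start (sys.L x₀))

/-- `σ` is a Markovian strategy of the product that is returned by (pessimistic) RDP: at each time
it selects a maximizer of the pessimistic Bellman operator. -/
def IsRDPStrategy (M : UMDP sys) (A : DFA (Set AP) Z) {T : ℕ} (σ : Fin T → M.S → Z → U) : Prop :=
  ∀ (t : Fin T) (s : M.S) (z : Z) (a : U),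
    M.pessAct A (M.pessValue A (T - t - 1)) a s z ≤
      M.pessAct A (M.pessValue A (T - t - 1)) (σ t s z) s z

end RDP

end UMDP

/-! ## The refined controller -/

theorem measurableSet_label (sys : ControlSystem X W U AP) (l : Set AP) :
    MeasurableSet {x | sys.L x = l} := by
  classical
  have h : {x | sys.L x = l} =
      ⋃₀ ((sys.R.filter (fun r => ∃ x ∈ r, sys.L x = l) : Finset (Set X)) : Set (Set X)) := by
    ext x
    simp only [Set.mem_ofPred_eq, Set.mem_sUnion, Finset.coe_filter]
    constructor
    · intro hx
      have : x ∈ ⋃₀ (sys.R : Set (Set X)) := by rw [sys.cover_regions]; trivial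
      obtain ⟨r, hr, hxr⟩ := this
      exact ⟨r, ⟨hr, x, hxr, hx⟩, hxr⟩
    · rintro ⟨r, ⟨hr, y, hy, hyl⟩, hxr⟩
      rw [sys.label_const r hr x hxr y hy, hyl]
  rw [h]
  refine MeasurableSet.sUnion (Finset.countable_toSet _) ?_
  intro r hr
  have hr' : r ∈ sys.R.filter (fun r => ∃ x ∈ r, sys.L x = l) := hr
  exact sys.measurableSet_region r (Finset.mem_filter.mp hr').1

theorem measurableSet_trace [MeasurableSpace U] (sys : ControlSystem X W U AP) {t : ℕ}
    (l : List (Set AP)) : MeasurableSet {ω : Trajectory X U t | sys.trace ω = l} := by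
  by_cases hl : l.length = t + 1
  · have h : {ω : Trajectory X U t | sys.trace ω = l} =
        ⋂ i : Fin (t + 1), (fun ω : Trajectory X U t => ω.1 i) ⁻¹'
          {x | sys.L x = l[(i : ℕ)]'(by omega)} := by
      ext ω
      simp only [trace, Set.mem_ofPred_eq, Set.mem_iInter, Set.mem_preimage]
      constructor
      · rintro rfl i
        simp only [List.getElem_ofFn, Fin.eta]
      · intro h
        apply List.ext_getElem
        · simp only [List.length_ofFn, hl]
        · intro i h1 h2
          rw [List.getElem_ofFn]
          exact h ⟨i, by omega⟩
    rw [h]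
    refine MeasurableSet.iInter fun i => ?_
    exact ((measurable_pi_apply i).comp measurable_fst) (sys.measurableSet_label _)
  · have h : {ω : Trajectory X U t | sys.trace ω = l} = ∅ := by
      ext ω
      simp only [Set.mem_ofPred_eq, Set.mem_empty_iff_false, iff_false]
      rintro rfl
      exact hl (by simp [trace])
    rw [h]
    exact MeasurableSet.empty

open Classical in
/-- The controller of the system obtained from a Markovian strategy `σ` of the product: after the
trajectory `x_0 ⋯ x_t` it applies `σ` at the product state made of the representative of `x_t` and
the state of the automaton after reading `L x_0 ⋯ L x_t`. Outside `Xabs` it applies `a₀`. -/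
def UMDP.refinedController [Finite AP] [MeasurableSpace U] {sys : ControlSystem X W U AP}
    (M : UMDP sys) {Z : Type*} (A : DFA (Set AP) Z) {T : ℕ} (σ : Fin T → M.S → Z → U) (a₀ : U) :
    sys.Controller T where
  act t ω := if h : ω.1 (Fin.last t) ∈ sys.Xabs
    then σ t (M.ρ ⟨ω.1 (Fin.last t), h⟩) (A.eval (sys.trace ω)) else a₀
  measurable_act t := by
    have hlast : Measurable fun ω : Trajectory X U t => ω.1 (Fin.last t) :=
      (measurable_pi_apply _).comp measurable_fst
    have habs : sys.Xabs = ⋃ s : M.S, M.cell s := by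
      ext x
      simp only [StatePartition.cell, Set.mem_iUnion]
      constructor
      · intro hx
        exact ⟨M.ρ ⟨x, hx⟩, ⟨x, hx⟩, rfl, rfl⟩
      · rintro ⟨s, y, _, rfl⟩
        exact y.2
    have hmabs : MeasurableSet sys.Xabs := by
      rw [habs]
      exact MeasurableSet.iUnion fun s => M.measurableSet_cell s
    intro V _
    have hV : (fun ω : Trajectory X U t => if h : ω.1 (Fin.last t) ∈ sys.Xabs
          then σ t (M.ρ ⟨ω.1 (Fin.last t), h⟩) (A.eval (sys.trace ω)) else a₀) ⁻¹' V =
        (⋃ s : M.S, ⋃ l : {l : List (Set AP) // σ t s (A.eval l) ∈ V},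
          ((fun ω : Trajectory X U t => ω.1 (Fin.last t)) ⁻¹' M.cell s ∩
            {ω | sys.trace ω = l.1})) ∪
        {ω | a₀ ∈ V ∧ ω.1 (Fin.last t) ∉ sys.Xabs} := by
      ext ω
      by_cases h : ω.1 (Fin.last t) ∈ sys.Xabs
      · simp [h, StatePartition.cell]
      · have h2 : ∀ s : M.S, ω.1 (Fin.last t) ∉ M.cell s := fun s hs =>
          h (by rw [habs]; exact Set.mem_iUnion.mpr ⟨s, hs⟩)
        simp [h, h2]
    rw [hV]
    refine MeasurableSet.union ?_ ?_
    · refine MeasurableSet.iUnion fun s => MeasurableSet.iUnion fun l => ?_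
      exact (hlast (M.measurableSet_cell s)).inter (sys.measurableSet_trace _)
    · exact (MeasurableSet.const _).inter (hlast hmabs.compl)

/-! ## Abstraction procedures and asymptotic optimality -/

/-- An abstraction procedure for the system: for each `η > 0` it returns a sound UMDP abstraction
whose partitions of `Xabs` and of `W` have size at most `η`. -/
structure AbstractionProcedure (sys : ControlSystem X W U AP) where
  umdp : ℝ → UMDP sys
  sound : ∀ η > 0, (umdp η).IsSound
  size_le : ∀ η > 0, (umdp η).size ≤ ENNReal.ofReal η
  size_C_le : ∀ η > 0, ∀ c ∈ (umdp η).C, Metric.ediam c ≤ ENNReal.ofReal (2 * η)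

/-- The specification `□ psafe ∧ φ`. -/
def spec (sys : ControlSystem X W U AP) (φ : LTLf AP) : LTLf AP :=
  LTLf.and (LTLf.globally (LTLf.atom sys.psafe)) φ

/-- Asymptotic optimality: for each formula and horizon, each automaton of the specification and
each outcome of RDP (ties in the maximization may be broken arbitrarily), the performance of the
synthesized controller and the lower and upper bounds converge to the optimal satisfaction
probability, uniformly in the initial state, as `η → 0`. -/
def AbstractionProcedure.AsymptoticallyOptimal [Finite AP] [MeasurableSpace U]
    {sys : ControlSystem X W U AP} (Abs : AbstractionProcedure sys) : Prop :=
  ∀ (φ : LTLf AP) (T : ℕ) (Z : Type) [Finite Z] (A : DFA (Set AP) Z),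
    (sys.spec φ).RecognizedBy A →
    ∀ (σ : (η : ℝ) → Fin T → (Abs.umdp η).S → Z → U) (a₀ : U),
      (∀ η > 0, (Abs.umdp η).IsRDPStrategy A (σ η)) →
      TendstoUniformly
        (fun η x₀ => sys.prob ((Abs.umdp η).refinedController A (σ η) a₀) (sys.spec φ) x₀)
        (fun x₀ => sys.optProb T (sys.spec φ) x₀) (𝓝[>] (0 : ℝ)) ∧
      TendstoUniformly (fun η x₀ => (Abs.umdp η).lowerBound A T x₀)
        (fun x₀ => sys.optProb T (sys.spec φ) x₀) (𝓝[>] (0 : ℝ)) ∧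
      TendstoUniformly (fun η x₀ => (Abs.umdp η).upperBound A T x₀)
        (fun x₀ => sys.optProb T (sys.spec φ) x₀) (𝓝[>] (0 : ℝ))

end ControlSystem

end

/-!
Let `V k` (`ControlSystem.bellmanValue`) be the value functions of the exact Bellman recursion on
the product of the system with the automaton. The three quantities of the theorem are compared with
`V T`, which turns out to be the optimal satisfaction probability.

*Continuity.* `V k` is uniformly continuous in the state, as long as the safe set is neither left
nor entered (`exists_bellmanValue_sub_le`). Two close states driven by the same disturbance have
close successors because the dynamics is Lipschitz. Their successors lie in the same region of
interest, and hence carry the same label, unless they are near the boundary of a region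
(`nearBoundary`). The latter event has small probability uniformly in the state and the action
(`exists_kernel_nearBoundary_le`): the transition kernels have bounded densities, and the states
near the boundaries shrink to a Lebesgue-null set inside the compact set `Xabs`.

*Convergence of robust dynamic programming.* By soundness, the discretized kernel of a safe state
is one of the distributions in the ambiguity set, so that each other distribution in it is
close to the discretized kernel in Wasserstein distance. A coupling of the two, together with
the continuity of `V k` away from the boundaries, shows that all of them give nearly the same
expected value, and that it is close to the exact one (`UMDP.abs_expect_sub_integral_le`). Hence the
pessimistic and the optimistic values both converge to `V k` uniformly, by induction on `k`
(`AbstractionProcedure.eventually_abs_value_sub_le`).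

*Sandwich.* Along the closed loop of any controller, the conditional expectation of the payoff
built from `V` does not increase, so that every controller has satisfaction probability at most
`V T` (`prob_le_bellmanValue`). Along the closed loop of the synthesized controller, that of the
payoff built from the pessimistic values does not decrease, so that the lower bound is at most the
probability achieved by this controller (`UMDP.lowerBound_le_prob`). The lower bound converges to
`V T`, hence so does the achieved probability, and `V T` is the optimal probability.
-/

/-! ### Preliminaries on bounded functions and couplings -/

/-- A function that depends measurably on its argument once a countable-valued measurable parameter
of that argument is fixed is measurable. -/
theorem measurable_of_countable_param {α ι β : Type*} [MeasurableSpace α] [MeasurableSpace β]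
    [Countable ι] {k : α → ι} (hk : ∀ i, MeasurableSet {a | k a = i}) {F : ι → α → β}
    (hF : ∀ i, Measurable (F i)) : Measurable fun a => F (k a) a := by
  intro B hB
  have : (fun a => F (k a) a) ⁻¹' B = ⋃ i, {a | k a = i} ∩ F i ⁻¹' B := by
    ext a
    simp
  rw [this]
  exact MeasurableSet.iUnion fun i => (hk i).inter (hF i hB)

theorem integrable_of_mem_Icc {Ω : Type*} [MeasurableSpace Ω] {π : Measure Ω} [IsFiniteMeasure π]
    {F : Ω → ℝ} (hF : Measurable F) (hF01 : ∀ ω, F ω ∈ Set.Icc (0 : ℝ) 1) : Integrable F π :=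
  Integrable.of_mem_Icc 0 1 hF.aemeasurable (ae_of_all _ hF01)

theorem integral_mem_Icc {Ω : Type*} [MeasurableSpace Ω] {π : Measure Ω} [IsProbabilityMeasure π]
    {F : Ω → ℝ} (hF01 : ∀ ω, F ω ∈ Set.Icc (0 : ℝ) 1) : ∫ ω, F ω ∂π ∈ Set.Icc (0 : ℝ) 1 := by
  refine ⟨integral_nonneg fun ω => (hF01 ω).1, ?_⟩
  by_cases hi : Integrable F π
  · calc ∫ ω, F ω ∂π ≤ ∫ _, (1 : ℝ) ∂π :=
          integral_mono hi (integrable_const _) fun ω => (hF01 ω).2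
      _ = 1 := by simp
  · rw [integral_undef hi]
    exact zero_le_one

/-- Two `[0, 1]`-valued functions that are `ε`-close off a set `B` have integrals that differ by at
most `ε` plus the probability of `B`. -/
theorem abs_integral_sub_integral_le {Ω : Type*} [MeasurableSpace Ω] {π : Measure Ω}
    [IsProbabilityMeasure π] {F G : Ω → ℝ} (hF : Measurable F) (hG : Measurable G)
    (hF01 : ∀ ω, F ω ∈ Set.Icc (0 : ℝ) 1) (hG01 : ∀ ω, G ω ∈ Set.Icc (0 : ℝ) 1) {B : Set Ω}
    (hB : MeasurableSet B) {ε : ℝ} (hε : 0 ≤ ε) (h : ∀ ω ∉ B, |F ω - G ω| ≤ ε) :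
    |∫ ω, F ω ∂π - ∫ ω, G ω ∂π| ≤ ε + π.real B := by
  have hFi := integrable_of_mem_Icc (π := π) hF hF01
  have hGi := integrable_of_mem_Icc (π := π) hG hG01
  rw [← integral_sub hFi hGi]
  have hIi : Integrable (B.indicator (fun _ => (1 : ℝ))) π := (integrable_const 1).indicator hB
  calc |∫ ω, (F ω - G ω) ∂π| ≤ ∫ ω, |F ω - G ω| ∂π := abs_integral_le_integral_abs
    _ ≤ ∫ ω, (ε + B.indicator (fun _ => (1 : ℝ)) ω) ∂π := by
        refine integral_mono (hFi.sub hGi).abs ((integrable_const ε).add hIi) fun ω => ?_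
        by_cases hω : ω ∈ B
        · have h1 := hF01 ω
          have h2 := hG01 ω
          have : |F ω - G ω| ≤ 1 := abs_sub_le_iff.2 ⟨by linarith [h1.2, h2.1],
            by linarith [h1.1, h2.2]⟩
          simp only [hω, Set.indicator_of_mem]
          linarith
        · simpa [hω] using h ω hω
    _ = ε + π.real B := by
        rw [integral_add (integrable_const ε) hIi, integral_indicator_const _ hB]
        simp

/-- A function that is nearly constant at scale `δ` off a set of small `μ`-measure has nearly the
same integral under every measure that is close to `μ` in Wasserstein distance. -/
theorem abs_integral_sub_integral_le_of_wasserstein_lt {E : Type*} [MeasurableSpace E]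
    [PseudoMetricSpace E] [SecondCountableTopology E] [BorelSpace E] {μ ν : Measure E}
    [IsProbabilityMeasure μ] {g : E → ℝ} (hg : Measurable g)
    (hg01 : ∀ x, g x ∈ Set.Icc (0 : ℝ) 1) {N : Set E} (hN : MeasurableSet N) {ε δ : ℝ}
    (hε : 0 < ε) (hδ : 0 < δ) (hμN : μ N ≤ ENNReal.ofReal ε)
    (h : ∀ p ∉ N, ∀ q, dist p q < δ → |g p - g q| ≤ ε)
    (hw : wasserstein μ ν < ENNReal.ofReal (δ * ε)) :
    |∫ x, g x ∂μ - ∫ x, g x ∂ν| ≤ 3 * ε := by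
  obtain ⟨⟨π, h1, h2⟩, hπ⟩ := iInf_lt_iff.1 hw
  simp only at hπ
  have : IsProbabilityMeasure π := by
    constructor
    rw [← Set.preimage_univ (f := Prod.fst), ← Measure.map_apply measurable_fst MeasurableSet.univ,
      h1, measure_univ]
  rw [← h1, ← h2, integral_map measurable_fst.aemeasurable hg.aestronglyMeasurable,
    integral_map measurable_snd.aemeasurable hg.aestronglyMeasurable]
  set D : Set (E × E) := {p | ENNReal.ofReal δ ≤ edist p.1 p.2} with hD
  have hDm : MeasurableSet D := measurableSet_le measurable_const measurable_edist
  have hDπ : π D ≤ ENNReal.ofReal ε := by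
    have hm := mul_meas_ge_le_lintegral₀ (μ := π)
      (measurable_edist (α := E)).aemeasurable (ENNReal.ofReal δ)
    have hm2 := hm.trans hπ.le
    rw [ENNReal.ofReal_mul hδ.le] at hm2
    exact (ENNReal.mul_le_mul_iff_right (ENNReal.ofReal_pos.2 hδ).ne' ENNReal.ofReal_ne_top).1 hm2
  have hNm : MeasurableSet (Prod.fst ⁻¹' N : Set (E × E)) := measurable_fst hN
  have hNπ : π (Prod.fst ⁻¹' N) ≤ ENNReal.ofReal ε := by
    rwa [← Measure.map_apply measurable_fst hN, h1]
  have hB : π.real (D ∪ Prod.fst ⁻¹' N) ≤ 2 * ε := by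
    refine ENNReal.toReal_le_of_le_ofReal (by positivity) ?_
    rw [two_mul, ENNReal.ofReal_add hε.le hε.le]
    exact (measure_union_le _ _).trans (add_le_add hDπ hNπ)
  have key := abs_integral_sub_integral_le (π := π) (hg.comp measurable_fst)
    (hg.comp measurable_snd) (fun _ => hg01 _) (fun _ => hg01 _) (hDm.union hNm) hε.le
    (fun p hp => by
      simp only [Set.mem_union, not_or] at hp
      refine h p.1 hp.2 p.2 ?_
      have : edist p.1 p.2 < ENNReal.ofReal δ := not_le.1 hp.1
      rwa [edist_dist, ENNReal.ofReal_lt_ofReal_iff hδ] at this)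
  simp only [Function.comp_apply] at key
  linarith

theorem abs_ciSup_sub_ciSup_le {ι : Type*} [Finite ι] [Nonempty ι] {f g : ι → ℝ} {ε : ℝ}
    (h : ∀ i, |f i - g i| ≤ ε) : |(⨆ i, f i) - ⨆ i, g i| ≤ ε := by
  have aux : ∀ f g : ι → ℝ, (∀ i, |f i - g i| ≤ ε) → (⨆ i, f i) ≤ (⨆ i, g i) + ε := by
    intro f g h
    refine ciSup_le fun i => ?_
    have := (abs_le.1 (h i)).2
    have := le_ciSup (Set.finite_range g).bddAbove i
    linarith
  rw [abs_sub_le_iff]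
  constructor
  · linarith [aux f g h]
  · linarith [aux g f fun i => by rw [abs_sub_comm]; exact h i]

theorem abs_csInf_sub_le {s : Set ℝ} (hs : s.Nonempty) {c ε : ℝ} (h : ∀ y ∈ s, |y - c| ≤ ε) :
    |sInf s - c| ≤ ε := by
  have h1 : c - ε ≤ sInf s := le_csInf hs fun y hy => by linarith [(abs_le.1 (h y hy)).1]
  obtain ⟨y, hy⟩ := hs
  have h2 : sInf s ≤ y := csInf_le ⟨c - ε, fun y hy => by linarith [(abs_le.1 (h y hy)).1]⟩ hy
  rw [abs_le]
  constructor <;> linarith [(abs_le.1 (h y hy)).2]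

theorem abs_csSup_sub_le {s : Set ℝ} (hs : s.Nonempty) {c ε : ℝ} (h : ∀ y ∈ s, |y - c| ≤ ε) :
    |sSup s - c| ≤ ε := by
  have h1 : sSup s ≤ c + ε := csSup_le hs fun y hy => by linarith [(abs_le.1 (h y hy)).2]
  obtain ⟨y, hy⟩ := hs
  have h2 : y ≤ sSup s := le_csSup ⟨c + ε, fun y hy => by linarith [(abs_le.1 (h y hy)).2]⟩ hy
  rw [abs_le]
  constructor <;> linarith [(abs_le.1 (h y hy)).1]

theorem ciSup_mem_Icc {ι : Type*} [Nonempty ι] {f : ι → ℝ}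
    (h : ∀ i, f i ∈ Set.Icc (0 : ℝ) 1) : (⨆ i, f i) ∈ Set.Icc (0 : ℝ) 1 := by
  refine ⟨Real.iSup_nonneg fun i => (h i).1, ciSup_le fun i => (h i).2⟩

theorem ciInf_mem_Icc {ι : Type*} [Nonempty ι] {f : ι → ℝ}
    (h : ∀ i, f i ∈ Set.Icc (0 : ℝ) 1) : (⨅ i, f i) ∈ Set.Icc (0 : ℝ) 1 := by
  obtain ⟨i⟩ := ‹Nonempty ι›
  exact ⟨Real.iInf_nonneg fun i => (h i).1,
    (ciInf_le ⟨0, by rintro _ ⟨i, rfl⟩; exact (h i).1⟩ i).trans (h i).2⟩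

namespace ControlSystem

variable {n d : ℕ} {X : Set (EuclideanSpace ℝ (Fin n))} {W : Set (EuclideanSpace ℝ (Fin d))}
  {U AP : Type*} {sys : ControlSystem X W U AP}

/-! ### Dynamics, regions of interest and the states near their boundaries -/

theorem exists_region (sys : ControlSystem X W U AP) (x : X) : ∃ r ∈ sys.R, x ∈ r := by
  have : x ∈ ⋃₀ (sys.R : Set (Set X)) := by rw [sys.cover_regions]; trivial
  exact this

theorem LipschitzDynamics.continuous (h : sys.LipschitzDynamics) (u : U) :
    Continuous fun p : X × W => sys.f p.1 u p.2 := by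
  obtain ⟨Lf, hLf, h⟩ := h
  refine (LipschitzWith.of_dist_le_mul (K := ⟨2 * Lf, by positivity⟩) fun p q => ?_).continuous
  refine (h p.1 q.1 p.2 q.2 u).trans ?_
  have h1 : dist p.1 q.1 ≤ dist p q := le_max_left _ _
  have h2 : dist p.2 q.2 ≤ dist p q := le_max_right _ _
  change _ ≤ 2 * Lf * dist p q
  nlinarith

theorem LipschitzDynamics.measurable_step (h : sys.LipschitzDynamics) (x : X) (u : U) :
    Measurable (sys.f x u) :=
  ((h.continuous u).comp (Continuous.prodMk_right x)).measurable

theorem LipschitzDynamics.isProbabilityMeasure_kernel (h : sys.LipschitzDynamics) (x : X) (u : U) :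
    IsProbabilityMeasure (sys.kernel x u) :=
  Measure.isProbabilityMeasure_map (h.measurable_step x u).aemeasurable

theorem LipschitzDynamics.integral_kernel (h : sys.LipschitzDynamics) {g : X → ℝ}
    (hg : Measurable g) (x : X) (u : U) :
    ∫ y, g y ∂(sys.kernel x u) = ∫ w, g (sys.f x u w) ∂(sys.PW : Measure W) :=
  integral_map (h.measurable_step x u).aemeasurable hg.aestronglyMeasurable

theorem isCompact_abs [Finite U] (h : sys.LipschitzDynamics) (hs : IsCompact sys.Xsafe) :
    IsCompact sys.Xabs := by
  have : CompactSpace W := isCompact_iff_compactSpace.1 sys.isCompact_W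
  have h1 : sys.Xabs = sys.Xsafe ∪
      ⋃ u : U, (fun p : X × W => sys.f p.1 u p.2) '' (sys.Xsafe ×ˢ Set.univ) := by
    ext y
    simp only [Xabs, Set.mem_union, Set.mem_iUnion, Set.mem_image, Set.mem_prod, Set.mem_univ,
      and_true, Prod.exists, Set.mem_ofPred_eq]
    refine or_congr Iff.rfl ⟨?_, ?_⟩
    · rintro ⟨x, hx, u, w, rfl⟩
      exact ⟨u, x, w, hx, rfl⟩
    · rintro ⟨u, x, w, hx, rfl⟩
      exact ⟨x, hx, u, w, rfl⟩
  rw [h1]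
  exact hs.union (isCompact_iUnion fun u => (hs.prod isCompact_univ).image (h.continuous u))

theorem kernel_compl_abs (h : sys.LipschitzDynamics) (hm : MeasurableSet sys.Xabs) {x : X}
    (hx : x ∈ sys.Xsafe) (u : U) : sys.kernel x u sys.Xabsᶜ = 0 := by
  rw [kernel, Measure.map_apply (h.measurable_step x u) hm.compl]
  convert! measure_empty (μ := (sys.PW : Measure W))
  ext w
  simp only [Set.mem_preimage, Set.mem_compl_iff, Set.mem_empty_iff_false, iff_false, not_not]
  exact Or.inr ⟨x, hx, u, w, rfl⟩

/-- The states at distance less than `δ` from a state of another region of interest. As `X` need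
not be connected, the distance is taken to other regions, not to their boundaries in `X`. -/
def nearBoundary (sys : ControlSystem X W U AP) (δ : ℝ) : Set X :=
  ⋃ r ∈ sys.R, r ∩ Metric.thickening δ rᶜ

theorem measurableSet_nearBoundary (sys : ControlSystem X W U AP) (δ : ℝ) :
    MeasurableSet (sys.nearBoundary δ) :=
  Finset.measurableSet_biUnion _ fun r hr =>
    (sys.measurableSet_region r hr).inter Metric.isOpen_thickening.measurableSet

theorem nearBoundary_mono (sys : ControlSystem X W U AP) {δ δ' : ℝ} (h : δ ≤ δ') :
    sys.nearBoundary δ ⊆ sys.nearBoundary δ' :=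
  Set.iUnion₂_mono fun _ _ => Set.inter_subset_inter_right _ (Metric.thickening_mono h _)

theorem mem_region_of_notMem_nearBoundary {δ : ℝ} {x y : X} (hx : x ∉ sys.nearBoundary δ)
    (hxy : dist x y < δ) {r : Set X} (hr : r ∈ sys.R) (hxr : x ∈ r) : y ∈ r := by
  by_contra hy
  exact hx (Set.mem_iUnion₂.2 ⟨r, hr, hxr, Metric.mem_thickening_iff.2 ⟨y, hy, hxy⟩⟩)

theorem label_eq_of_notMem_nearBoundary {δ : ℝ} {x y : X} (hx : x ∉ sys.nearBoundary δ)
    (hxy : dist x y < δ) : sys.L x = sys.L y := by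
  obtain ⟨r, hr, hxr⟩ := sys.exists_region x
  exact sys.label_const r hr x hxr y (mem_region_of_notMem_nearBoundary hx hxy hr hxr)

theorem safe_iff_of_label_eq {x y : X} (h : sys.L x = sys.L y) :
    x ∈ sys.Xsafe ↔ y ∈ sys.Xsafe := by
  rw [← sys.psafe_mem, ← sys.psafe_mem, h]

/-- A bounded density charges the states near the boundaries of the regions of interest little,
uniformly in the safe state and the action: these states shrink to the boundaries, which are
Lebesgue-null. -/
theorem exists_kernel_nearBoundary_le [Finite U] (h_safe : sys.CompactSafeNullBoundary)
    (h_density : sys.BoundedDensity) (h_lip : sys.LipschitzDynamics) {ε : ℝ} (hε : 0 < ε) :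
    ∃ δ > 0, ∀ x ∈ sys.Xsafe, ∀ u, sys.kernel x u (sys.nearBoundary δ) ≤ ENNReal.ofReal ε := by
  obtain ⟨τ, hτ, hker, M, hM⟩ := h_density
  have hK := isCompact_abs h_lip h_safe.1
  have hfin : sys.lebesgue sys.Xabs < ∞ := by
    rw [lebesgue, comap_subtype_coe_apply sys.measurableSet_X]
    exact (hK.image continuous_subtype_val).measure_lt_top
  have hbd : ∀ x ∈ sys.Xsafe, ∀ u, ∀ N : Set X, MeasurableSet N →
      sys.kernel x u N ≤ M * sys.lebesgue (N ∩ sys.Xabs) := by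
    intro x hx u N hN
    calc sys.kernel x u N ≤ sys.kernel x u ((N ∩ sys.Xabs) ∪ sys.Xabsᶜ) := by
          refine measure_mono fun y hy => ?_
          by_cases hy' : y ∈ sys.Xabs
          · exact Or.inl ⟨hy, hy'⟩
          · exact Or.inr hy'
      _ ≤ sys.kernel x u (N ∩ sys.Xabs) + 0 := by
          rw [← kernel_compl_abs h_lip hK.measurableSet hx u]
          exact measure_union_le _ _
      _ ≤ M * sys.lebesgue (N ∩ sys.Xabs) := by
          rw [add_zero, hker, withDensity_apply _ (hN.inter hK.measurableSet),
            ← setLIntegral_const]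
          exact lintegral_mono fun y => ENNReal.coe_le_coe.2 (hM x u y)
  have hlim : ∀ r ∈ sys.R, Tendsto (fun δ : ℝ =>
      (M : ℝ≥0∞) * sys.lebesgue (r ∩ Metric.thickening δ rᶜ ∩ sys.Xabs)) (𝓝[>] 0) (𝓝 0) := by
    intro r hr
    have hrm := sys.measurableSet_region r hr
    have hm := hrm.inter hK.measurableSet
    have : IsFiniteMeasure (sys.lebesgue.restrict (r ∩ sys.Xabs)) :=
      ⟨by rw [Measure.restrict_apply_univ]
          exact (measure_mono Set.inter_subset_right).trans_lt hfin⟩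
    have ht := tendsto_measure_thickening (μ := sys.lebesgue.restrict (r ∩ sys.Xabs)) (s := rᶜ)
      ⟨1, one_pos, measure_ne_top _ _⟩
    have h0 : sys.lebesgue.restrict (r ∩ sys.Xabs) (closure rᶜ) = 0 := by
      rw [Measure.restrict_apply' hm]
      refine measure_mono_null ?_ (h_safe.2 r hr)
      rintro y ⟨hy, hyr, -⟩
      rw [frontier_eq_closure_inter_closure]
      exact ⟨subset_closure hyr, hy⟩
    rw [h0] at ht
    have := ENNReal.Tendsto.const_mul (a := (M : ℝ≥0∞)) ht (Or.inr ENNReal.coe_ne_top)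
    rw [mul_zero] at this
    refine this.congr fun δ => ?_
    rw [Measure.restrict_apply' hm]
    congr 2
    ext y
    simp only [Set.mem_inter_iff]
    tauto
  have hsum := tendsto_finsetSum sys.R hlim
  rw [Finset.sum_const_zero] at hsum
  have hev := (hsum.eventually (gt_mem_nhds (ENNReal.ofReal_pos.2 hε))).and self_mem_nhdsWithin
  obtain ⟨δ, hδ, hδ0⟩ := hev.exists
  refine ⟨δ, hδ0, fun x hx u => (hbd x hx u _ (sys.measurableSet_nearBoundary δ)).trans ?_⟩
  refine le_trans ?_ hδ.le
  rw [← Finset.mul_sum]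
  gcongr
  rw [nearBoundary, Set.iUnion₂_inter]
  exact measure_biUnion_finset_le _ _

end ControlSystem

namespace ControlSystem

variable {n d : ℕ} {X : Set (EuclideanSpace ℝ (Fin n))} {W : Set (EuclideanSpace ℝ (Fin d))}
  {U AP : Type*} {sys : ControlSystem X W U AP}

/-! ### The optimal value functions of the product with the automaton -/

theorem measurable_comp_label [Finite AP] {Z β : Type*} [MeasurableSpace β] {v : X → Z → β}
    (hv : ∀ z, Measurable fun x => v x z) (F : Set AP → Z) :
    Measurable fun y => v y (F (sys.L y)) :=
  measurable_of_countable_param sys.measurableSet_label (F := fun l y => v y (F l))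
    fun _ => hv _

open Classical in
/-- The exact Bellman recursion on the product of the system with the automaton `A`. It follows the
conventions of `UMDP.pess`: accepting product states have value `1` and unsafe ones value `0`. -/
noncomputable def bellmanValue (sys : ControlSystem X W U AP) {Z : Type*} (A : DFA (Set AP) Z) :
    ℕ → X → Z → ℝ
  | 0 => UMDP.value₀ A
  | k + 1 => fun x z =>
      if x ∈ sys.Xsafe then
        if z ∈ A.accept then 1
        else ⨆ a : U, ∫ y, bellmanValue sys A k y (A.step z (sys.L y)) ∂(sys.kernel x a)
      else 0

variable {Z : Type*} {A : DFA (Set AP) Z}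

theorem value₀_mem_Icc (x : X) (z : Z) : UMDP.value₀ A x z ∈ Set.Icc (0 : ℝ) 1 := by
  classical
  simp only [UMDP.value₀, Set.indicator_apply]
  split_ifs <;> simp

theorem bellmanValue_mem_Icc [Nonempty U] (h_lip : sys.LipschitzDynamics) (k : ℕ) (x : X) (z : Z) :
    sys.bellmanValue A k x z ∈ Set.Icc (0 : ℝ) 1 := by
  induction k generalizing x z with
  | zero => exact value₀_mem_Icc x z
  | succ k ih =>
    simp only [bellmanValue]
    split_ifs
    · simp
    · refine ciSup_mem_Icc fun a => ?_
      have := h_lip.isProbabilityMeasure_kernel x a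
      exact integral_mem_Icc fun y => ih y _
    · simp

theorem measurable_bellmanValue [Finite AP] [Finite U] (h_lip : sys.LipschitzDynamics)
    (hs : MeasurableSet sys.Xsafe) (k : ℕ) (z : Z) :
    Measurable fun x => sys.bellmanValue A k x z := by
  classical
  induction k generalizing z with
  | zero => exact measurable_const
  | succ k ih =>
    simp only [bellmanValue]
    refine Measurable.ite hs ?_ measurable_const
    split_ifs
    · exact measurable_const
    · refine Measurable.iSup fun a => ?_
      have hg : Measurable fun y => sys.bellmanValue A k y (A.step z (sys.L y)) :=
        measurable_comp_label ih _
      simp only [h_lip.integral_kernel hg]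
      have : StronglyMeasurable fun p : X × W =>
          sys.bellmanValue A k (sys.f p.1 a p.2) (A.step z (sys.L (sys.f p.1 a p.2))) :=
        (hg.comp (h_lip.continuous a).measurable).stronglyMeasurable
      exact this.integral_prod_right.measurable

theorem bellmanValue_of_accept {x : X} (hx : x ∈ sys.Xsafe) {z : Z} (hz : z ∈ A.accept) (k : ℕ) :
    sys.bellmanValue A k x z = 1 := by
  cases k with
  | zero => simp [bellmanValue, UMDP.value₀, hz]
  | succ k => simp [bellmanValue, hx, hz]

/-- The value vanishes at automaton states from which no accepting state can be reached. -/
theorem bellmanValue_of_dead {z : Z} (hz : ∀ l, A.evalFrom z l ∉ A.accept) (k : ℕ) (x : X) :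
    sys.bellmanValue A k x z = 0 := by
  induction k generalizing x z with
  | zero => simp [bellmanValue, UMDP.value₀, show z ∉ A.accept from hz []]
  | succ k ih =>
    have h0 : ∀ y, sys.bellmanValue A k y (A.step z (sys.L y)) = 0 := fun y =>
      ih (z := A.step z (sys.L y)) (fun l => by
        simpa [DFA.evalFrom_cons] using hz (sys.L y :: l)) y
    simp [bellmanValue, show z ∉ A.accept from hz [], h0]

/-- At most `ε` is lost in the value when the state moves by less than `δ`, provided that the safe
set is not left or entered. The modulus of continuity is propagated through the Bellman recursion
by running the two states with the same disturbance: the successors then stay close, and they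
have the same label unless they are near the boundary of a region of interest. -/
theorem exists_bellmanValue_sub_le [Finite AP] [Finite U] [Nonempty U]
    (h_safe : sys.CompactSafeNullBoundary) (h_density : sys.BoundedDensity)
    (h_lip : sys.LipschitzDynamics) (A : DFA (Set AP) Z) (k : ℕ) {ε : ℝ} (hε : 0 < ε) :
    ∃ δ > 0, ∀ x y : X, (x ∈ sys.Xsafe ↔ y ∈ sys.Xsafe) → dist x y < δ → ∀ z,
      |sys.bellmanValue A k x z - sys.bellmanValue A k y z| ≤ ε := by
  induction k generalizing ε with
  | zero => exact ⟨1, one_pos, fun x y _ _ z => by simpa [bellmanValue, UMDP.value₀] using hε.le⟩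
  | succ k ih =>
    obtain ⟨δ₁, hδ₁, h1⟩ := ih (half_pos hε)
    obtain ⟨δ₂, hδ₂, h2⟩ := exists_kernel_nearBoundary_le h_safe h_density h_lip (half_pos hε)
    obtain ⟨Lf, hLf, hf⟩ := id h_lip
    have hδ : 0 < min δ₁ δ₂ := lt_min hδ₁ hδ₂
    refine ⟨min δ₁ δ₂ / (Lf + 1), by positivity, fun x y hxy hd z => ?_⟩
    by_cases hx : x ∈ sys.Xsafe
    swap
    · simpa [bellmanValue, hx, mt hxy.2 hx] using hε.le
    by_cases hz : z ∈ A.accept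
    · simpa [bellmanValue, hx, hxy.1 hx, hz] using hε.le
    simp only [bellmanValue, hx, hxy.1 hx, hz, if_true, if_false]
    refine abs_ciSup_sub_ciSup_le fun a => ?_
    have hV : ∀ y z, sys.bellmanValue A k y z ∈ Set.Icc (0 : ℝ) 1 := bellmanValue_mem_Icc h_lip k
    have hg : Measurable fun y => sys.bellmanValue A k y (A.step z (sys.L y)) :=
      measurable_comp_label (measurable_bellmanValue h_lip h_safe.1.measurableSet k) _
    rw [h_lip.integral_kernel hg, h_lip.integral_kernel hg]
    have hB := h2 x hx a
    have hN := sys.measurableSet_nearBoundary δ₂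
    rw [kernel, Measure.map_apply (h_lip.measurable_step x a) hN] at hB
    have key := abs_integral_sub_integral_le (π := (sys.PW : Measure W))
      (hg.comp (h_lip.measurable_step x a)) (hg.comp (h_lip.measurable_step y a))
      (fun _ => hV _ _) (fun _ => hV _ _) (h_lip.measurable_step x a hN) (half_pos hε).le
      fun w hw => ?_
    · have hBr := ENNReal.toReal_le_of_le_ofReal (half_pos hε).le hB
      simp only [Function.comp_apply, Measure.real] at key
      linarith
    · have hdw : dist (sys.f x a w) (sys.f y a w) < min δ₁ δ₂ := by
        have h3 := hf x y w w a
        rw [dist_self, add_zero] at h3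
        have h4 := (lt_div_iff₀ (by positivity)).1 hd
        have := dist_nonneg (x := x) (y := y)
        nlinarith
      have hlab : sys.L (sys.f x a w) = sys.L (sys.f y a w) :=
        label_eq_of_notMem_nearBoundary hw (hdw.trans_le (min_le_right _ _))
      simp only [Function.comp_apply, ← hlab]
      exact h1 _ _ (safe_iff_of_label_eq hlab) (hdw.trans_le (min_le_left _ _)) _

end ControlSystem

namespace ControlSystem

variable {n d : ℕ} {X : Set (EuclideanSpace ℝ (Fin n))} {W : Set (EuclideanSpace ℝ (Fin d))}
  {U AP : Type*} {sys : ControlSystem X W U AP}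

/-! ### Cells of a partition and the discretized kernel -/

namespace StatePartition

variable (P : StatePartition sys)

theorem mem_cell_iff {s : P.S} {y : X} : y ∈ P.cell s ↔ ∃ h : y ∈ sys.Xabs, P.ρ ⟨y, h⟩ = s := by
  simp [cell]

theorem rep_mem_cell (s : P.S) : (s : X) ∈ P.cell s :=
  P.mem_cell_iff.2 ⟨P.S_subset s s.2, P.ρ_rep s⟩

theorem iUnion_cell : ⋃ s : P.S, P.cell s = sys.Xabs := by
  ext y
  simp only [Set.mem_iUnion, mem_cell_iff]
  exact ⟨fun ⟨_, h, _⟩ => h, fun h => ⟨_, h, rfl⟩⟩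

theorem pairwise_disjoint_cell : Pairwise (Function.onFun Disjoint P.cell) := by
  intro s t hst
  refine Set.disjoint_left.2 fun y hs ht => hst ?_
  obtain ⟨h, rfl⟩ := P.mem_cell_iff.1 hs
  obtain ⟨_, rfl⟩ := P.mem_cell_iff.1 ht
  rfl

theorem region_of_mem_cell {s : P.S} {y y' : X} (hy : y ∈ P.cell s) (hy' : y' ∈ P.cell s)
    {r : Set X} (hr : r ∈ sys.R) (hyr : y ∈ r) : y' ∈ r := by
  rcases P.respects s r hr with h | h
  · exact h hy'
  · exact absurd hyr (h hy)

theorem label_of_mem_cell {s : P.S} {y y' : X} (hy : y ∈ P.cell s) (hy' : y' ∈ P.cell s) :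
    sys.L y = sys.L y' := by
  obtain ⟨r, hr, hyr⟩ := sys.exists_region y
  exact sys.label_const r hr y hyr y' (P.region_of_mem_cell hy hy' hr hyr)

theorem dist_lt_of_mem_cell {η δ : ℝ} (hη : P.size ≤ ENNReal.ofReal η) (hδ : 0 < δ)
    (hηδ : 2 * η < δ) {s : P.S} {y y' : X} (hy : y ∈ P.cell s) (hy' : y' ∈ P.cell s) :
    dist y y' < δ := by
  have h1 : Metric.ediam (P.cell s) ≤ ENNReal.ofReal (2 * η) := by
    have h2 : Metric.ediam (P.cell s) / 2 ≤ ENNReal.ofReal η :=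
      (ENNReal.div_le_div_right (le_iSup (fun s => Metric.ediam (P.cell s)) s) 2).trans hη
    rw [ENNReal.div_le_iff two_ne_zero ENNReal.ofNat_ne_top] at h2
    rwa [mul_comm 2 η, ENNReal.ofReal_mul' zero_le_two, ENNReal.ofReal_ofNat]
  have h3 : edist y y' < ENNReal.ofReal δ :=
    ((Metric.edist_le_ediam_of_mem hy hy').trans h1).trans_lt
      ((ENNReal.ofReal_lt_ofReal_iff hδ).2 hηδ)
  rwa [edist_dist, ENNReal.ofReal_lt_ofReal_iff hδ] at h3

theorem measurableSet_abs (P : StatePartition sys) : MeasurableSet sys.Xabs := by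
  rw [← P.iUnion_cell]
  exact MeasurableSet.iUnion P.measurableSet_cell

variable {x : X} {a : U}

theorem integral_kernel_eq_sum (h_lip : sys.LipschitzDynamics) (hx : x ∈ sys.Xsafe) {g : X → ℝ}
    (hg : Integrable g (sys.kernel x a)) :
    ∫ y, g y ∂(sys.kernel x a) = ∑ s : P.S, ∫ y in P.cell s, g y ∂(sys.kernel x a) := by
  have h := integral_iUnion_fintype (s := P.cell) P.measurableSet_cell P.pairwise_disjoint_cell
    (fun _ => hg.integrableOn)
  rw [← h, P.iUnion_cell, Measure.restrict_eq_self_of_ae_mem]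
  rw [ae_iff]
  exact kernel_compl_abs h_lip P.measurableSet_abs hx a

theorem sum_kernel_cell (h_lip : sys.LipschitzDynamics) (hx : x ∈ sys.Xsafe) :
    ∑ s : P.S, (sys.kernel x a).real (P.cell s) = 1 := by
  have := h_lip.isProbabilityMeasure_kernel x a
  have h := P.integral_kernel_eq_sum h_lip hx (a := a) (integrable_const (1 : ℝ))
  simpa using h.symm

/-- The discretized kernel integrates a lower bound of `g` on each cell to a lower bound of the
integral of `g`. -/
theorem sum_kernel_cell_mul_le_integral (h_lip : sys.LipschitzDynamics) (hx : x ∈ sys.Xsafe)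
    {g : X → ℝ} (hg : Integrable g (sys.kernel x a)) {c : P.S → ℝ}
    (hc : ∀ s, ∀ y ∈ P.cell s, c s ≤ g y) :
    ∑ s : P.S, (sys.kernel x a).real (P.cell s) * c s ≤ ∫ y, g y ∂(sys.kernel x a) := by
  have := h_lip.isProbabilityMeasure_kernel x a
  rw [P.integral_kernel_eq_sum h_lip hx hg]
  refine Finset.sum_le_sum fun s _ => ?_
  rw [← smul_eq_mul, ← setIntegral_const]
  exact setIntegral_mono_on (integrableOn_const) hg.integrableOn (P.measurableSet_cell s) (hc s)

/-- Replacing the kernel by its discretization changes the expectation of a function by no more than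
the function varies on the cells. -/
theorem abs_sum_kernel_cell_mul_sub_le (h_lip : sys.LipschitzDynamics) (hx : x ∈ sys.Xsafe)
    {g : X → ℝ} (hg : Integrable g (sys.kernel x a)) {ε : ℝ}
    (hε : ∀ s : P.S, ∀ y ∈ P.cell s, |g y - g s| ≤ ε) :
    |∑ s : P.S, (sys.kernel x a).real (P.cell s) * g s - ∫ y, g y ∂(sys.kernel x a)| ≤ ε := by
  have h1 := P.sum_kernel_cell_mul_le_integral h_lip hx hg (c := fun s => g s - ε)
    fun s y hy => by linarith [(abs_le.1 (hε s y hy)).1]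
  have h2 := P.sum_kernel_cell_mul_le_integral h_lip hx hg.neg (c := fun s => -g s - ε)
    fun s y hy => by
      simp only [Pi.neg_apply]
      linarith [(abs_le.1 (hε s y hy)).2]
  simp only [mul_sub, Finset.sum_sub_distrib, ← Finset.sum_mul, P.sum_kernel_cell h_lip hx,
    mul_neg, Finset.sum_neg_distrib, Pi.neg_apply, integral_neg] at h1 h2
  rw [abs_le]
  constructor <;> linarith

end StatePartition

namespace UMDP

variable (M : UMDP sys) {Z : Type*}

theorem integral_toMeasure {γ : M.S → ℝ} (hγ : ∀ s, 0 ≤ γ s) {g : X → ℝ} (hg : Measurable g) :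
    ∫ y, g y ∂(M.toMeasure γ) = ∑ s : M.S, γ s * g s := by
  rw [toMeasure, integral_finsetSum_measure]
  · refine Finset.sum_congr rfl fun s _ => ?_
    rw [integral_smul_measure, integral_dirac' _ _ hg.stronglyMeasurable,
      ENNReal.toReal_ofReal (hγ s), smul_eq_mul]
  · intro s _
    exact (integrable_dirac' hg.stronglyMeasurable enorm_lt_top).smul_measure ENNReal.ofReal_ne_top

theorem isProbabilityMeasure_toMeasure {γ : M.S → ℝ} (hγ : γ ∈ stdSimplex ℝ M.S) :
    IsProbabilityMeasure (M.toMeasure γ) := by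
  constructor
  simp only [toMeasure, Measure.finsetSum_apply, Measure.smul_apply, measure_univ, smul_eq_mul,
    mul_one]
  rw [← ENNReal.ofReal_sum_of_nonneg fun s _ => hγ.1 s, hγ.2, ENNReal.ofReal_one]

theorem wasserstein_le_ambiguityDiameter {s : M.S} (hs : (s : X) ∈ sys.Xsafe) {a : U}
    {γ γ' : M.S → ℝ} (hγ : γ ∈ M.Γ s a) (hγ' : γ' ∈ M.Γ s a) :
    wasserstein (M.toMeasure γ) (M.toMeasure γ') ≤ M.ambiguityDiameter :=
  le_iSup₂_of_le s hs <| le_iSup_of_le a <| le_iSup₂_of_le γ hγ <|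
    le_iSup₂_of_le γ' hγ' le_rfl

theorem rep_safe {x : X} (hx : x ∈ sys.Xsafe) :
    ((M.ρ ⟨x, sys.safe_subset_abs hx⟩ : M.S) : X) ∈ sys.Xsafe := by
  have h : x ∈ M.cell (M.ρ ⟨x, sys.safe_subset_abs hx⟩) := M.mem_cell_iff.2 ⟨_, rfl⟩
  exact (safe_iff_of_label_eq (M.label_of_mem_cell h (M.rep_mem_cell _))).1 hx

/-- The discretized kernel puts little mass on the representatives near the boundary of a region of
interest, since their cells consist of states near that boundary. -/
theorem toMeasure_kernel_nearBoundary_le (h_lip : sys.LipschitzDynamics) {x : X} {a : U} {δ : ℝ}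
    (hcell : ∀ s : M.S, ∀ y ∈ M.cell s, dist y s < δ) :
    M.toMeasure (fun s => (sys.kernel x a).real (M.cell s)) (sys.nearBoundary δ) ≤
      sys.kernel x a (sys.nearBoundary (2 * δ)) := by
  classical
  have := h_lip.isProbabilityMeasure_kernel x a
  have hN := sys.measurableSet_nearBoundary δ
  calc M.toMeasure (fun s => (sys.kernel x a).real (M.cell s)) (sys.nearBoundary δ)
      = ∑ s ∈ Finset.univ.filter (fun s : M.S => (s : X) ∈ sys.nearBoundary δ),
          sys.kernel x a (M.cell s) := by
        simp only [toMeasure, Measure.finsetSum_apply, Measure.smul_apply, smul_eq_mul,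
          Measure.dirac_apply' _ hN, Set.indicator_apply, Pi.one_apply, mul_ite, mul_one, mul_zero,
          Finset.sum_filter, ofReal_measureReal (measure_ne_top _ _)]
    _ = sys.kernel x a (⋃ s ∈ Finset.univ.filter
          (fun s : M.S => (s : X) ∈ sys.nearBoundary δ), M.cell s) :=
        (measure_biUnion_finset (fun s _ t _ hst => M.pairwise_disjoint_cell hst)
          fun s _ => M.measurableSet_cell s).symm
    _ ≤ sys.kernel x a (sys.nearBoundary (2 * δ)) := by
        refine measure_mono fun y hy => ?_
        obtain ⟨s, hs, hys⟩ := Set.mem_iUnion₂.1 hy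
        obtain ⟨r, hr, hsr, hst⟩ := Set.mem_iUnion₂.1 (Finset.mem_filter.1 hs).2
        obtain ⟨q, hq, hsq⟩ := Metric.mem_thickening_iff.1 hst
        refine Set.mem_iUnion₂.2 ⟨r, hr, M.region_of_mem_cell (M.rep_mem_cell s) hys hr hsr,
          Metric.mem_thickening_iff.2 ⟨q, hq, ?_⟩⟩
        linarith [dist_triangle y s q, hcell s y hys]

/-! ### Robust Bellman operators against the exact one -/

section Minorizer

variable {v : X → Z → ℝ}

theorem minorizer_rep (s : M.S) (z : Z) :
    M.minorizer v s z = ⨅ y : {y : sys.Xabs // M.ρ y = s}, v y.1 z := by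
  rw [minorizer, dif_pos (M.S_subset s s.2), M.ρ_rep]

instance (s : M.S) : Nonempty {y : sys.Xabs // M.ρ y = s} := ⟨⟨_, M.ρ_rep s⟩⟩

theorem minorizer_mem_Icc (hv : ∀ x z, v x z ∈ Set.Icc (0 : ℝ) 1) (s : M.S) (z : Z) :
    M.minorizer v s z ∈ Set.Icc (0 : ℝ) 1 := by
  rw [minorizer_rep]
  exact ciInf_mem_Icc fun y => hv _ _

theorem minorizer_le (hv : ∀ x z, v x z ∈ Set.Icc (0 : ℝ) 1) {s : M.S} {y : X}
    (hy : y ∈ M.cell s) (z : Z) : M.minorizer v s z ≤ v y z := by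
  rw [minorizer_rep]
  obtain ⟨h, hs⟩ := M.mem_cell_iff.1 hy
  exact ciInf_le (f := fun y : {y : sys.Xabs // M.ρ y = s} => v y.1 z)
    ⟨0, by rintro _ ⟨i, rfl⟩; exact (hv _ _).1⟩ ⟨⟨y, h⟩, hs⟩

theorem le_minorizer {s : M.S} {z : Z} {c : ℝ} (h : ∀ y ∈ M.cell s, c ≤ v y z) :
    c ≤ M.minorizer v s z := by
  rw [minorizer_rep]
  exact le_ciInf fun y => h _ (M.mem_cell_iff.2 ⟨y.1.2, y.2⟩)

theorem expect_mem_Icc (hv : ∀ x z, v x z ∈ Set.Icc (0 : ℝ) 1) (A : DFA (Set AP) Z) (z : Z)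
    {γ : M.S → ℝ} (hγ : γ ∈ stdSimplex ℝ M.S) : M.expect A v z γ ∈ Set.Icc (0 : ℝ) 1 := by
  refine ⟨Finset.sum_nonneg fun s _ => mul_nonneg (hγ.1 s) (M.minorizer_mem_Icc hv s _).1, ?_⟩
  calc M.expect A v z γ ≤ ∑ s, γ s * 1 := Finset.sum_le_sum fun s _ =>
        mul_le_mul_of_nonneg_left (M.minorizer_mem_Icc hv s _).2 (hγ.1 s)
    _ = 1 := by simpa using hγ.2

end Minorizer

/-- For each ambiguous distribution `γ` of a safe state, the expectation used in robust dynamic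
programming is close to the exact expected value `V` of the successor, when `v` is uniformly close
to `V`, the cells are small compared with the modulus of continuity `δ` of `V`, and the ambiguity
sets are small in Wasserstein distance compared with `δ * ε`. Passing from `v` to `V` and
from a cell to its representative costs `2 * ε`, passing from `γ` to the discretized kernel
costs `3 * ε`, and passing from the latter to the kernel costs `ε`. -/
theorem abs_expect_sub_integral_le [Finite AP] (h_lip : sys.LipschitzDynamics) (hM : M.IsSound)
    (A : DFA (Set AP) Z) {v V : X → Z → ℝ} (hV : ∀ z, Measurable fun x => V x z)
    (hV01 : ∀ x z, V x z ∈ Set.Icc (0 : ℝ) 1) {ε δ η : ℝ} (hε : 0 < ε) (hδ : 0 < δ)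
    (hvV : ∀ x z, |v x z - V x z| ≤ ε)
    (hVδ : ∀ x y : X, (x ∈ sys.Xsafe ↔ y ∈ sys.Xsafe) → dist x y < δ → ∀ z, |V x z - V y z| ≤ ε)
    (hη : M.size ≤ ENNReal.ofReal η) (hηδ : 2 * η < δ)
    (hamb : M.ambiguityDiameter < ENNReal.ofReal (δ * ε)) {x : X} (hx : x ∈ sys.Xsafe) {a : U}
    (hnear : sys.kernel x a (sys.nearBoundary (2 * δ)) ≤ ENNReal.ofReal ε) (z : Z)
    {γ : M.S → ℝ} (hγ : γ ∈ M.Γ (M.ρ ⟨x, sys.safe_subset_abs hx⟩) a) :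
    |M.expect A v z γ - ∫ y, V y (A.step z (sys.L y)) ∂(sys.kernel x a)| ≤ 6 * ε := by
  have := h_lip.isProbabilityMeasure_kernel x a
  set g : X → ℝ := fun y => V y (A.step z (sys.L y)) with hg
  have hgm : Measurable g := measurable_comp_label hV _
  have hg01 : ∀ y, g y ∈ Set.Icc (0 : ℝ) 1 := fun y => hV01 _ _
  have hcell : ∀ s : M.S, ∀ y ∈ M.cell s, dist y s < δ := fun s y hy =>
    M.dist_lt_of_mem_cell hη hδ hηδ hy (M.rep_mem_cell s)
  have hcellV : ∀ s : M.S, ∀ y ∈ M.cell s, ∀ z, |V y z - V s z| ≤ ε := fun s y hy =>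
    hVδ y s (safe_iff_of_label_eq (M.label_of_mem_cell hy (M.rep_mem_cell s))) (hcell s y hy)
  have hγS := M.Γ_subset _ _ hγ
  set γ₀ : M.S → ℝ := fun s => (sys.kernel x a).real (M.cell s) with hγ₀
  have hγ₀Γ : γ₀ ∈ M.Γ (M.ρ ⟨x, sys.safe_subset_abs hx⟩) a := hM.1 x hx a
  have hγ₀S := M.Γ_subset _ _ hγ₀Γ
  have h1 : |M.expect A v z γ - ∑ s : M.S, γ s * g s| ≤ 2 * ε := by
    have hm : ∀ s : M.S, |M.minorizer v s (A.step z (sys.L s)) - g s| ≤ 2 * ε := by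
      intro s
      rw [abs_le]
      constructor
      · have : g s - 2 * ε ≤ M.minorizer v s (A.step z (sys.L s)) := by
          refine M.le_minorizer fun y hy => ?_
          have h1 := (abs_le.1 (hcellV s y hy (A.step z (sys.L s)))).1
          have h2 := (abs_le.1 (hvV y (A.step z (sys.L s)))).1
          simp only [hg]
          linarith
        linarith
      · have hb : M.minorizer v s (A.step z (sys.L s)) ≤ v s (A.step z (sys.L s)) := by
          rw [minorizer_rep]
          refine ciInf_le (f := fun y : {y : sys.Xabs // M.ρ y = s} => v y.1 _)
            ⟨-ε, ?_⟩ ⟨_, M.ρ_rep s⟩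
          rintro _ ⟨i, rfl⟩
          have h1 := (abs_le.1 (hvV i.1 (A.step z (sys.L s)))).1
          have h2 := (hV01 i.1 (A.step z (sys.L s))).1
          simp only
          linarith
        have h2 := (abs_le.1 (hvV s (A.step z (sys.L s)))).2
        simp only [hg]
        linarith
    rw [expect, ← Finset.sum_sub_distrib]
    calc |∑ s : M.S, (γ s * M.minorizer v s (A.step z (sys.L s)) - γ s * g s)|
        ≤ ∑ s : M.S, |γ s * M.minorizer v s (A.step z (sys.L s)) - γ s * g s| :=
          Finset.abs_sum_le_sum_abs _ _
      _ ≤ ∑ s : M.S, γ s * (2 * ε) := by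
          refine Finset.sum_le_sum fun s _ => ?_
          rw [← mul_sub, abs_mul, abs_of_nonneg (hγS.1 s)]
          exact mul_le_mul_of_nonneg_left (hm s) (hγS.1 s)
      _ = 2 * ε := by rw [← Finset.sum_mul, hγS.2, one_mul]
  have h2 : |∑ s : M.S, γ₀ s * g s - ∑ s : M.S, γ s * g s| ≤ 3 * ε := by
    rw [← M.integral_toMeasure hγS.1 hgm, ← M.integral_toMeasure hγ₀S.1 hgm]
    have := M.isProbabilityMeasure_toMeasure hγ₀S
    refine abs_integral_sub_integral_le_of_wasserstein_lt hgm hg01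
      (sys.measurableSet_nearBoundary δ) hε hδ
      ((M.toMeasure_kernel_nearBoundary_le h_lip hcell).trans hnear) (fun p hp q hpq => ?_)
      ((M.wasserstein_le_ambiguityDiameter (M.rep_safe hx) hγ₀Γ hγ).trans_lt hamb)
    have hlab := label_eq_of_notMem_nearBoundary hp hpq
    simp only [hg, ← hlab]
    exact hVδ p q (safe_iff_of_label_eq hlab) hpq _
  have h3 : |∑ s : M.S, γ₀ s * g s - ∫ y, g y ∂(sys.kernel x a)| ≤ ε := by
    refine M.abs_sum_kernel_cell_mul_sub_le h_lip hx (integrable_of_mem_Icc hgm hg01)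
      fun s y hy => ?_
    simp only [hg, M.label_of_mem_cell hy (M.rep_mem_cell s)]
    exact hcellV s y hy _
  rw [abs_le] at h1 h2 h3 ⊢
  constructor <;> linarith [h1.1, h1.2, h2.1, h2.2, h3.1, h3.2]

end UMDP

/-- The pessimistic and the optimistic value functions converge uniformly to the exact ones. -/
theorem AbstractionProcedure.eventually_abs_value_sub_le [Finite AP] [Finite U] [Nonempty U]
    (h_safe : sys.CompactSafeNullBoundary) (h_density : sys.BoundedDensity)
    (h_lip : sys.LipschitzDynamics) (Abs : AbstractionProcedure sys)
    (h_amb : Tendsto (fun η : ℝ => (Abs.umdp η).ambiguityDiameter) (𝓝[>] (0 : ℝ)) (𝓝 0))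
    {Z : Type*} (A : DFA (Set AP) Z) (k : ℕ) {ε : ℝ} (hε : 0 < ε) :
    ∀ᶠ η in 𝓝[>] (0 : ℝ), ∀ x z,
      |(Abs.umdp η).pessValue A k x z - sys.bellmanValue A k x z| ≤ ε ∧
      |(Abs.umdp η).optValue A k x z - sys.bellmanValue A k x z| ≤ ε := by
  induction k generalizing ε with
  | zero =>
    refine Eventually.of_forall fun η x z => ?_
    simpa [UMDP.pessValue, UMDP.optValue, bellmanValue] using hε.le
  | succ k ih =>
    have hε' : 0 < ε / 6 := by positivity
    have h6 : 6 * (ε / 6) = ε := by ring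
    obtain ⟨δ₁, hδ₁, h1⟩ := exists_bellmanValue_sub_le h_safe h_density h_lip A k hε'
    obtain ⟨δ₂, hδ₂, h2⟩ := exists_kernel_nearBoundary_le h_safe h_density h_lip hε'
    set δ := min δ₁ (δ₂ / 2) with hδdef
    have hδ : 0 < δ := lt_min hδ₁ (half_pos hδ₂)
    have hδ1 : δ ≤ δ₁ := min_le_left _ _
    have hδ2 : 2 * δ ≤ δ₂ := by linarith [min_le_right δ₁ (δ₂ / 2)]
    have hamb := h_amb.eventually (gt_mem_nhds (ENNReal.ofReal_pos.2 (mul_pos hδ hε')))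
    have hsmall : ∀ᶠ η : ℝ in 𝓝[>] 0, η < δ / 2 :=
      nhdsWithin_le_nhds (gt_mem_nhds (half_pos hδ))
    filter_upwards [ih hε', hamb, hsmall, self_mem_nhdsWithin] with η hih hφ hηδ hη x z
    have hM := Abs.sound η hη
    simp only [UMDP.pessValue, UMDP.optValue, Function.iterate_succ_apply'] at hih ⊢
    simp only [UMDP.pess, UMDP.opt, bellmanValue]
    by_cases hx : x ∈ sys.Xsafe
    swap
    · simpa [hx] using hε.le
    simp only [hx, dif_pos, if_true, UMDP.pessAct, UMDP.optAct]
    by_cases hz : z ∈ A.accept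
    · simpa [hz] using hε.le
    simp only [hz, if_false]
    have hstep : ∀ v : X → Z → ℝ, (∀ x z, |v x z - sys.bellmanValue A k x z| ≤ ε / 6) →
        ∀ a, ∀ y ∈ (Abs.umdp η).expect A v z ''
          (Abs.umdp η).Γ ((Abs.umdp η).ρ ⟨x, sys.safe_subset_abs hx⟩) a,
        |y - ∫ y, sys.bellmanValue A k y (A.step z (sys.L y)) ∂(sys.kernel x a)| ≤ ε := by
      rintro v hv a _ ⟨γ, hγ, rfl⟩
      rw [← h6]
      exact (Abs.umdp η).abs_expect_sub_integral_le h_lip hM A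
        (measurable_bellmanValue h_lip h_safe.1.measurableSet k) (bellmanValue_mem_Icc h_lip k)
        hε' hδ hv (fun x y hxy hd => h1 x y hxy (hd.trans_le hδ1)) (Abs.size_le η hη)
        (by linarith) hφ hx
        ((measure_mono (sys.nearBoundary_mono hδ2)).trans (h2 x hx a)) z hγ
    have hne : ∀ (v : X → Z → ℝ) a, ((Abs.umdp η).expect A v z ''
        (Abs.umdp η).Γ ((Abs.umdp η).ρ ⟨x, sys.safe_subset_abs hx⟩) a).Nonempty := fun v a =>
      Set.Nonempty.image _ ⟨_, hM.1 x hx a⟩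
    exact ⟨abs_ciSup_sub_ciSup_le fun a =>
        abs_csInf_sub_le (hne _ a) (hstep _ (fun x z => (hih x z).1) a),
      abs_ciSup_sub_ciSup_le fun a =>
        abs_csSup_sub_le (hne _ a) (hstep _ (fun x z => (hih x z).2) a)⟩

end ControlSystem

/-! ### One step of the closed loop -/

/-- Resampling one coordinate of an i.i.d. vector does not change expectations. -/
theorem integral_pi_eq_integral_update {W : Type*} [MeasurableSpace W] (P : Measure W)
    [IsProbabilityMeasure P] {T : ℕ} (i : Fin T) {F : (Fin T → W) → ℝ} (hF : Measurable F)
    (hF01 : ∀ w, F w ∈ Set.Icc (0 : ℝ) 1) :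
    ∫ w, F w ∂(Measure.pi fun _ => P) =
      ∫ w, ∫ y, F (Function.update w i y) ∂P ∂(Measure.pi fun _ => P) := by
  cases T with
  | zero => exact i.elim0
  | succ T =>
    have hmp := (measurePreserving_piFinSuccAbove (fun _ : Fin (T + 1) => P) i).symm
    rw [← hmp.integral_comp', ← hmp.integral_comp']
    have hupd : ∀ (p : W × (Fin T → W)) (y : W),
        Function.update ((MeasurableEquiv.piFinSuccAbove (fun _ => W) i).symm p) i y =
          (MeasurableEquiv.piFinSuccAbove (fun _ => W) i).symm (y, p.2) := by
      intro p y
      simp [MeasurableEquiv.piFinSuccAbove_symm_apply, Fin.insertNthEquiv]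
    simp only [hupd]
    rw [integral_fun_snd (fun q => ∫ y, F ((MeasurableEquiv.piFinSuccAbove (fun _ => W) i).symm
      (y, q)) ∂P), integral_prod_symm]
    · simp
    · exact integrable_of_mem_Icc (hF.comp (MeasurableEquiv.measurable _)) fun _ => hF01 _

namespace ControlSystem

variable {n d : ℕ} {X : Set (EuclideanSpace ℝ (Fin n))} {W : Set (EuclideanSpace ℝ (Fin d))}
  {U AP : Type*} {sys : ControlSystem X W U AP}

/-- The trajectory `ω` extended by the action `u` and the successor `y`. -/
def extend {S U : Type*} {t : ℕ} (ω : Trajectory S U t) (u : U) (y : S) : Trajectory S U (t + 1) :=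
  (Fin.snoc (α := fun _ => S) ω.1 y, Fin.snoc (α := fun _ => U) ω.2 u)

theorem measurable_snoc {S : Type*} [MeasurableSpace S] (t : ℕ) :
    Measurable fun p : (Fin t → S) × S => (Fin.snoc (α := fun _ => S) p.1 p.2 : Fin (t + 1) → S) := by
  refine measurable_pi_iff.2 fun i => ?_
  refine Fin.lastCases ?_ (fun j => ?_) i
  · simpa using measurable_snd
  · simp only [Fin.snoc_castSucc]
    exact (measurable_pi_apply j).comp measurable_fst

theorem measurable_extend {S U : Type*} [MeasurableSpace S] [MeasurableSpace U] (t : ℕ) :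
    Measurable fun p : Trajectory S U t × U × S => extend p.1 p.2.1 p.2.2 :=
  ((measurable_snoc _).comp
    ((measurable_fst.comp measurable_fst).prodMk (measurable_snd.comp measurable_snd))).prodMk
  ((measurable_snoc _).comp
    ((measurable_snd.comp measurable_fst).prodMk (measurable_fst.comp measurable_snd)))

theorem LipschitzDynamics.measurable_f [Finite U] [MeasurableSpace U] [DiscreteMeasurableSpace U]
    (h : sys.LipschitzDynamics) : Measurable fun p : X × U × W => sys.f p.1 p.2.1 p.2.2 :=
  measurable_of_countable_param (k := fun p : X × U × W => p.2.1)
    (F := fun u p => sys.f p.1 u p.2.2)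
    (fun u => (measurable_fst.comp measurable_snd) (MeasurableSet.of_discrete (s := {u})))
    fun u => (h.continuous u).measurable.comp
      (measurable_fst.prodMk (measurable_snd.comp measurable_snd))

section ClosedLoop

variable [MeasurableSpace U] {T : ℕ} (κ : sys.Controller T) (x₀ : X)

theorem closedLoop_succ (w : Fin T → W) (t : ℕ) (h : t + 1 ≤ T) :
    sys.closedLoop κ x₀ w (t + 1) h =
      extend (sys.closedLoop κ x₀ w t (Nat.le_of_succ_le h))
        (κ.act ⟨t, h⟩ (sys.closedLoop κ x₀ w t (Nat.le_of_succ_le h)))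
        (sys.f ((sys.closedLoop κ x₀ w t (Nat.le_of_succ_le h)).1 (Fin.last t))
          (κ.act ⟨t, h⟩ (sys.closedLoop κ x₀ w t (Nat.le_of_succ_le h))) (w ⟨t, h⟩)) :=
  rfl

theorem closedLoop_congr {w w' : Fin T → W} (t : ℕ) (h : t ≤ T)
    (hw : ∀ j : Fin T, (j : ℕ) < t → w j = w' j) :
    sys.closedLoop κ x₀ w t h = sys.closedLoop κ x₀ w' t h := by
  induction t with
  | zero => rfl
  | succ t ih =>
    rw [closedLoop_succ, closedLoop_succ, ih _ fun j hj => hw j (by omega),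
      hw ⟨t, h⟩ (Nat.lt_succ_self t)]

theorem measurable_closedLoop [Finite U] [DiscreteMeasurableSpace U]
    (h_lip : sys.LipschitzDynamics) (t : ℕ) (h : t ≤ T) :
    Measurable fun w => sys.closedLoop κ x₀ w t h := by
  induction t with
  | zero => exact measurable_const
  | succ t ih =>
    simp only [closedLoop_succ]
    have h1 := ih (Nat.le_of_succ_le h)
    have h2 := (κ.measurable_act ⟨t, h⟩).comp h1
    have h3 := ((measurable_pi_apply (Fin.last t)).comp measurable_fst).comp h1
    exact (measurable_extend t).comp (h1.prodMk (h2.prodMk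
      (h_lip.measurable_f.comp (h3.prodMk (h2.prodMk (measurable_pi_apply _))))))

/-- A function of the trajectory whose conditional expectation never increases along a step of the
closed loop has final expectation at most its initial value. -/
theorem integral_closedLoop_le [Finite U] [DiscreteMeasurableSpace U]
    (h_lip : sys.LipschitzDynamics) {Φ : (t : ℕ) → Trajectory X U t → ℝ}
    (hΦ : ∀ t, Measurable (Φ t)) (hΦ01 : ∀ t ω, Φ t ω ∈ Set.Icc (0 : ℝ) 1)
    (hstep : ∀ (t : Fin T) (ω : Trajectory X U t),
      ∫ y, Φ (t + 1) (extend ω (κ.act t ω) y) ∂(sys.kernel (ω.1 (Fin.last t)) (κ.act t ω)) ≤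
        Φ t ω) :
    ∫ w, Φ T (sys.closedLoop κ x₀ w T le_rfl) ∂(Measure.pi fun _ => (sys.PW : Measure W)) ≤
      Φ 0 (fun _ => x₀, Fin.elim0) := by
  have key : ∀ t (h : t ≤ T),
      ∫ w, Φ t (sys.closedLoop κ x₀ w t h) ∂(Measure.pi fun _ => (sys.PW : Measure W)) ≤
        Φ 0 (fun _ => x₀, Fin.elim0) := by
    intro t
    induction t with
    | zero => intro h; simp [closedLoop]
    | succ t ih =>
      intro h
      refine le_trans ?_ (ih (Nat.le_of_succ_le h))
      have hm : Measurable fun w => Φ (t + 1) (sys.closedLoop κ x₀ w (t + 1) h) :=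
        (hΦ _).comp (measurable_closedLoop κ x₀ h_lip _ h)
      rw [integral_pi_eq_integral_update (sys.PW : Measure W) ⟨t, h⟩ hm fun w => hΦ01 _ _]
      have hsm : StronglyMeasurable fun p : (Fin T → W) × W =>
          Φ (t + 1) (sys.closedLoop κ x₀ (Function.update p.1 ⟨t, h⟩ p.2) (t + 1) h) :=
        (hm.comp measurable_update').stronglyMeasurable
      refine integral_mono
        (integrable_of_mem_Icc hsm.integral_prod_right.measurable
          fun w => integral_mem_Icc fun y => hΦ01 _ _)
        (integrable_of_mem_Icc ((hΦ t).comp (measurable_closedLoop κ x₀ h_lip t _))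
          fun w => hΦ01 _ _) fun w => ?_
      have hcl : ∀ y, sys.closedLoop κ x₀ (Function.update w ⟨t, h⟩ y) t (Nat.le_of_succ_le h) =
          sys.closedLoop κ x₀ w t (Nat.le_of_succ_le h) := fun y =>
        closedLoop_congr κ x₀ t _ fun j hj =>
          Function.update_of_ne (Fin.ne_of_val_ne hj.ne) _ _
      simp only [closedLoop_succ, hcl, Function.update_self]
      refine le_of_eq_of_le ?_ (hstep ⟨t, h⟩ _)
      refine (h_lip.integral_kernel (g := fun y => Φ (t + 1) (extend _ _ y)) ?_ _ _).symm
      exact (hΦ _).comp ((measurable_extend t).comp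
        (measurable_const.prodMk (measurable_const.prodMk measurable_id)))
  exact key T le_rfl

theorem le_integral_closedLoop [Finite U] [DiscreteMeasurableSpace U]
    (h_lip : sys.LipschitzDynamics) {Φ : (t : ℕ) → Trajectory X U t → ℝ}
    (hΦ : ∀ t, Measurable (Φ t)) (hΦ01 : ∀ t ω, Φ t ω ∈ Set.Icc (0 : ℝ) 1)
    (hstep : ∀ (t : Fin T) (ω : Trajectory X U t), Φ t ω ≤
      ∫ y, Φ (t + 1) (extend ω (κ.act t ω) y) ∂(sys.kernel (ω.1 (Fin.last t)) (κ.act t ω))) :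
    Φ 0 (fun _ => x₀, Fin.elim0) ≤
      ∫ w, Φ T (sys.closedLoop κ x₀ w T le_rfl) ∂(Measure.pi fun _ => (sys.PW : Measure W)) := by
  have h := integral_closedLoop_le κ x₀ h_lip (Φ := fun t ω => 1 - Φ t ω)
    (fun t => measurable_const.sub (hΦ t))
    (fun t ω => ⟨by linarith [(hΦ01 t ω).2], by linarith [(hΦ01 t ω).1]⟩) fun t ω => by
      have := h_lip.isProbabilityMeasure_kernel (ω.1 (Fin.last t)) (κ.act t ω)
      rw [integral_sub (integrable_const _), integral_const, probReal_univ, one_smul]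
      · linarith [hstep t ω]
      · exact integrable_of_mem_Icc ((hΦ _).comp ((measurable_extend _).comp
          (measurable_const.prodMk (measurable_const.prodMk measurable_id)))) fun y => hΦ01 _ _
  rw [integral_sub (integrable_const _), integral_const, probReal_univ, one_smul] at h
  · linarith
  · exact integrable_of_mem_Icc ((hΦ _).comp (measurable_closedLoop κ x₀ h_lip _ _))
      fun w => hΦ01 _ _

end ClosedLoop

/-! ### Satisfaction probabilities along the closed loop -/

theorem trace_extend {t : ℕ} (ω : Trajectory X U t) (u : U) (y : X) :
    sys.trace (extend ω u y) = sys.trace ω ++ [sys.L y] := by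
  rw [trace, List.ofFn_succ', List.concat_eq_append]
  simp only [extend, Fin.snoc_castSucc, Fin.snoc_last, trace]

theorem length_trace {t : ℕ} (ω : Trajectory X U t) : (sys.trace ω).length = t + 1 := by
  simp [trace]

theorem satisfies_extend_iff {t : ℕ} (ω : Trajectory X U t) (u : U) (y : X) (φ : LTLf AP) :
    sys.Satisfies (extend ω u y) φ ↔
      sys.Satisfies ω φ ∨ LTLf.Models (sys.trace ω ++ [sys.L y]) φ := by
  have hlen := length_trace (sys := sys) ω
  simp only [Satisfies, trace_extend]
  constructor
  · rintro ⟨k, hk, h⟩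
    rcases Nat.lt_or_ge k (t + 1) with hk' | hk'
    · rw [List.take_append_of_le_length (by omega)] at h
      exact Or.inl ⟨k, by omega, h⟩
    · rw [List.take_of_length_le (by simp; omega)] at h
      exact Or.inr h
  · rintro (⟨k, hk, h⟩ | h)
    · exact ⟨k, by omega, by rwa [List.take_append_of_le_length (by omega)]⟩
    · exact ⟨t + 1, le_rfl, by rwa [List.take_of_length_le (by simp; omega)]⟩

theorem psafe_mem_of_models {φ : LTLf AP} {l : List (Set AP)} (h : LTLf.Models l (sys.spec φ))
    {a : Set AP} (ha : a ∈ l) : sys.psafe ∈ a := by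
  obtain ⟨i, hi, rfl⟩ := List.mem_iff_getElem.1 ha
  have h1 := h.1
  simp only [LTLf.globally, LTLf.eventually, LTLf.Sat, not_exists, not_and] at h1
  by_contra hc
  exact h1 i (Nat.zero_le i) hi (fun _ => hc) fun _ _ _ => trivial

section Payoff

variable {Z : Type*} {A : DFA (Set AP) Z} {φ : LTLf AP}

theorem eval_mem_accept_iff (hrec : φ.RecognizedBy A) {l : List (Set AP)} (hl : l ≠ []) :
    A.eval l ∈ A.accept ↔ LTLf.Models l φ :=
  hrec l hl

theorem trace_ne_nil {t : ℕ} (ω : Trajectory X U t) : sys.trace ω ≠ [] := by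
  rw [← List.length_pos_iff, length_trace]
  exact Nat.succ_pos t

open Classical in
/-- The value of a partial trajectory: `1` once it satisfies `φ`, and otherwise the value `v` of the
current product state. -/
noncomputable def payoff (sys : ControlSystem X W U AP) (A : DFA (Set AP) Z) (φ : LTLf AP)
    (v : X → Z → ℝ) {t : ℕ} (ω : Trajectory X U t) : ℝ :=
  if sys.Satisfies ω φ then 1 else v (ω.1 (Fin.last t)) (A.eval (sys.trace ω))

theorem payoff_mem_Icc {v : X → Z → ℝ} (hv : ∀ x z, v x z ∈ Set.Icc (0 : ℝ) 1) {t : ℕ}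
    (ω : Trajectory X U t) : sys.payoff A φ v ω ∈ Set.Icc (0 : ℝ) 1 := by
  rw [payoff]
  split_ifs
  · simp
  · exact hv _ _

theorem measurable_payoff [Finite AP] [MeasurableSpace U] {v : X → Z → ℝ}
    (hv : ∀ z, Measurable fun x => v x z) (t : ℕ) :
    Measurable fun ω : Trajectory X U t => sys.payoff A φ v ω := by
  classical
  have h := measurable_of_countable_param (k := fun ω : Trajectory X U t => sys.trace ω)
    (F := fun l ω => if ∃ k ≤ t, LTLf.Models (l.take (k + 1)) φ then 1
      else v (ω.1 (Fin.last t)) (A.eval l)) (fun l => measurableSet_trace sys l) fun l => ?_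
  · convert h using 2 with ω
    rw [payoff]
    congr
  · split_ifs
    · exact measurable_const
    · exact (hv _).comp ((measurable_pi_apply _).comp measurable_fst)

theorem not_models_trace {t : ℕ} {ω : Trajectory X U t} (h : ¬ sys.Satisfies ω φ) :
    ¬ LTLf.Models (sys.trace ω) φ := fun hm =>
  h ⟨t, le_rfl, by rwa [List.take_of_length_le (length_trace ω).le]⟩

theorem payoff_extend_of_satisfies {v : X → Z → ℝ} {t : ℕ} {ω : Trajectory X U t}
    (h : sys.Satisfies ω φ) (u : U) (y : X) : sys.payoff A φ v (extend ω u y) = 1 :=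
  if_pos ((satisfies_extend_iff ω u y φ).2 (Or.inl h))

/-- Before the specification is satisfied, the value after one more step is that of the new product
state: if that step completes an accepted trace, then it ends in a safe state. -/
theorem payoff_extend_of_not_satisfies {v : X → Z → ℝ} (hrec : (sys.spec φ).RecognizedBy A)
    (hv : ∀ x ∈ sys.Xsafe, ∀ z ∈ A.accept, v x z = 1) {t : ℕ} {ω : Trajectory X U t}
    (h : ¬ sys.Satisfies ω (sys.spec φ)) (u : U) (y : X) :
    sys.payoff A (sys.spec φ) v (extend ω u y) = v y (A.step (A.eval (sys.trace ω)) (sys.L y)) := by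
  have hl : (extend ω u y).1 (Fin.last (t + 1)) = y := by simp [extend]
  rw [payoff, satisfies_extend_iff, trace_extend, hl, DFA.eval_append_singleton]
  split_ifs with hs
  · have hm := hs.resolve_left h
    refine (hv y ((sys.psafe_mem y).1 (psafe_mem_of_models hm (by simp))) _ ?_).symm
    rw [← DFA.eval_append_singleton]
    exact (eval_mem_accept_iff hrec (by simp)).2 hm
  · rfl

theorem payoff_init {v : X → Z → ℝ} (hrec : (sys.spec φ).RecognizedBy A)
    (hv : ∀ x ∈ sys.Xsafe, ∀ z ∈ A.accept, v x z = 1) (x₀ : X) :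
    sys.payoff A (sys.spec φ) v ((fun _ => x₀, Fin.elim0) : Trajectory X U 0) =
      v x₀ (A.step A.start (sys.L x₀)) := by
  have ht : sys.trace ((fun _ => x₀, Fin.elim0) : Trajectory X U 0) = [sys.L x₀] := by simp [trace]
  rw [payoff, ht, DFA.eval_singleton]
  split_ifs with hs
  · obtain ⟨k, -, hm⟩ := hs
    rw [ht, List.take_of_length_le (by simp)] at hm
    refine (hv x₀ ((sys.psafe_mem x₀).1 (psafe_mem_of_models hm (by simp))) _ ?_).symm
    rw [← DFA.eval_singleton]
    exact (eval_mem_accept_iff hrec (by simp)).2 hm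
  · rfl

theorem prob_eq_integral_payoff [Finite AP] [Finite U] [MeasurableSpace U]
    [DiscreteMeasurableSpace U] (h_lip : sys.LipschitzDynamics) (hrec : φ.RecognizedBy A) {T : ℕ}
    (κ : sys.Controller T) (x₀ : X) :
    sys.prob κ φ x₀ = ∫ w, sys.payoff A φ (UMDP.value₀ A) (sys.closedLoop κ x₀ w T le_rfl)
      ∂(Measure.pi fun _ => (sys.PW : Measure W)) := by
  classical
  have hind : ∀ ω : Trajectory X U T, sys.payoff A φ (UMDP.value₀ A) ω =
      {ω : Trajectory X U T | sys.Satisfies ω φ}.indicator (fun _ => (1 : ℝ)) ω := by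
    intro ω
    by_cases h : sys.Satisfies ω φ
    · simp [payoff, h]
    · have := mt (eval_mem_accept_iff hrec (trace_ne_nil ω)).1 (not_models_trace h)
      simp [payoff, h, UMDP.value₀, this]
  have hms : MeasurableSet {ω : Trajectory X U T | sys.Satisfies ω φ} := by
    have hm : Measurable fun ω : Trajectory X U T => sys.payoff A φ (UMDP.value₀ A) ω :=
      measurable_payoff (v := UMDP.value₀ A) (fun z => measurable_const) T
    convert hm (measurableSet_singleton (1 : ℝ)) using 1
    ext ω
    by_cases h : sys.Satisfies ω φ <;> simp [hind, h]
  have hcl := measurable_closedLoop κ x₀ h_lip T le_rfl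
  rw [prob, trajMeasure, map_measureReal_apply hcl hms, ← integral_indicator_one (hcl hms)]
  simp only [hind]
  rfl

end Payoff

end ControlSystem

namespace ControlSystem

variable {n d : ℕ} {X : Set (EuclideanSpace ℝ (Fin n))} {W : Set (EuclideanSpace ℝ (Fin d))}
  {U AP : Type*} {sys : ControlSystem X W U AP} {Z : Type*} {A : DFA (Set AP) Z} {φ : LTLf AP}

/-! ### Optimality of the Bellman recursion and performance of the synthesized controller -/

/-- The automaton cannot accept once it has read a trace that ends in an unsafe state. -/
theorem evalFrom_notMem_accept_of_not_safe (hrec : (sys.spec φ).RecognizedBy A) {t : ℕ}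
    {ω : Trajectory X U t} (hx : ω.1 (Fin.last t) ∉ sys.Xsafe) (l : List (Set AP)) :
    A.evalFrom (A.eval (sys.trace ω)) l ∉ A.accept := by
  have h1 : A.evalFrom (A.eval (sys.trace ω)) l = A.eval (sys.trace ω ++ l) := by
    simp [DFA.eval, DFA.evalFrom_of_append]
  rw [h1, eval_mem_accept_iff hrec (by simp [trace_ne_nil])]
  intro hm
  refine hx ((sys.psafe_mem _).1 (psafe_mem_of_models hm (List.mem_append_left _ ?_)))
  exact List.mem_ofFn.2 ⟨_, rfl⟩

/-- No controller does better than the exact Bellman recursion. -/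
theorem prob_le_bellmanValue [Finite AP] [Finite U] [Nonempty U] [MeasurableSpace U]
    [DiscreteMeasurableSpace U] (hs : MeasurableSet sys.Xsafe) (h_lip : sys.LipschitzDynamics)
    (hrec : (sys.spec φ).RecognizedBy A) {T : ℕ} (κ : sys.Controller T) (x₀ : X) :
    sys.prob κ (sys.spec φ) x₀ ≤ sys.bellmanValue A T x₀ (A.step A.start (sys.L x₀)) := by
  have hV1 : ∀ k, ∀ x ∈ sys.Xsafe, ∀ z ∈ A.accept, sys.bellmanValue A k x z = 1 :=
    fun k x hx z hz => bellmanValue_of_accept hx hz k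
  have key := integral_closedLoop_le κ x₀ h_lip
    (Φ := fun t ω => sys.payoff A (sys.spec φ) (sys.bellmanValue A (T - t)) ω)
    (fun t => measurable_payoff (measurable_bellmanValue h_lip hs _) t)
    (fun t ω => payoff_mem_Icc (bellmanValue_mem_Icc h_lip _) ω) fun t ω => ?_
  · rw [prob_eq_integral_payoff h_lip hrec]
    simp only [Nat.sub_self, Nat.sub_zero] at key
    exact key.trans_eq (payoff_init hrec (hV1 T) x₀)
  · have := h_lip.isProbabilityMeasure_kernel (ω.1 (Fin.last t)) (κ.act t ω)
    obtain ⟨k, hk⟩ : ∃ k, T - t = k + 1 := ⟨T - t - 1, by omega⟩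
    have hk' : T - (t + 1) = k := by omega
    rw [hk, hk']
    by_cases h : sys.Satisfies ω (sys.spec φ)
    · simp only [payoff_extend_of_satisfies h]
      simp [payoff, h]
    · simp only [payoff_extend_of_not_satisfies hrec (hV1 k) h]
      rw [payoff, if_neg h]
      have hz := mt (eval_mem_accept_iff hrec (trace_ne_nil ω)).1 (not_models_trace h)
      by_cases hx : ω.1 (Fin.last t) ∈ sys.Xsafe
      · simp only [bellmanValue, hx, hz, if_true, if_false]
        exact le_ciSup (f := fun a => ∫ y, sys.bellmanValue A k y
          (A.step (A.eval (sys.trace ω)) (sys.L y)) ∂(sys.kernel (ω.1 (Fin.last t)) a))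
          (Set.finite_range _).bddAbove _
      · have h0 : ∀ y, sys.bellmanValue A k y (A.step (A.eval (sys.trace ω)) (sys.L y)) = 0 :=
          fun y => bellmanValue_of_dead (fun l => by
            simpa [DFA.evalFrom_cons] using
              evalFrom_notMem_accept_of_not_safe hrec hx (sys.L y :: l)) k y
        simp [h0, bellmanValue, hx]

namespace UMDP

variable (M : UMDP sys)

theorem pessAct_mem_Icc {v : X → Z → ℝ} (hv : ∀ x z, v x z ∈ Set.Icc (0 : ℝ) 1) (a : U) (s : M.S)
    (z : Z) : M.pessAct A v a s z ∈ Set.Icc (0 : ℝ) 1 := by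
  have hsub : ∀ y ∈ M.expect A v z '' M.Γ s a, y ∈ Set.Icc (0 : ℝ) 1 := by
    rintro _ ⟨γ, hγ, rfl⟩
    exact M.expect_mem_Icc hv A z (M.Γ_subset s a hγ)
  rw [pessAct]
  split_ifs
  · simp
  · refine ⟨Real.sInf_nonneg fun y hy => (hsub y hy).1, ?_⟩
    rcases (M.expect A v z '' M.Γ s a).eq_empty_or_nonempty with h | ⟨y, hy⟩
    · simp [h]
    · exact (csInf_le ⟨0, fun y hy => (hsub y hy).1⟩ hy).trans (hsub y hy).2

theorem pessValue_mem_Icc [Nonempty U] (k : ℕ) (x : X) (z : Z) :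
    M.pessValue A k x z ∈ Set.Icc (0 : ℝ) 1 := by
  induction k generalizing x z with
  | zero => exact value₀_mem_Icc x z
  | succ k ih =>
    rw [pessValue, Function.iterate_succ_apply', pess]
    split_ifs
    · exact ciSup_mem_Icc fun a => M.pessAct_mem_Icc ih a _ z
    · simp

theorem pessValue_of_accept [Nonempty U] {x : X} (hx : x ∈ sys.Xsafe) {z : Z} (hz : z ∈ A.accept)
    (k : ℕ) : M.pessValue A k x z = 1 := by
  cases k with
  | zero => simp [pessValue, value₀, hz]
  | succ k => simp [pessValue, Function.iterate_succ_apply', pess, pessAct, hx, hz]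

theorem measurable_pessValue (hs : MeasurableSet sys.Xsafe) (k : ℕ) (z : Z) :
    Measurable fun x => M.pessValue A k x z := by
  classical
  cases k with
  | zero => exact measurable_const
  | succ k =>
    -- On the safe set the value depends on the state through its cell only.
    have h := measurable_of_countable_param (ι := Option M.S)
      (k := fun x : X => if h : x ∈ sys.Xabs then some (M.ρ ⟨x, h⟩) else none)
      (F := fun o x => if x ∈ sys.Xsafe then
        o.elim 0 (fun s => ⨆ a : U, M.pessAct A (M.pessValue A k) a s z) else 0)
      (fun o => ?_) (fun o => Measurable.ite hs measurable_const measurable_const)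
    · convert h using 2 with x
      rw [pessValue, Function.iterate_succ_apply', pess]
      by_cases hx : x ∈ sys.Xsafe
      · simp [hx, sys.safe_subset_abs hx, pessValue]
      · simp [hx]
    · cases o with
      | none =>
        convert M.measurableSet_abs.compl using 1
        ext x
        by_cases hx : x ∈ sys.Xabs <;> simp [hx]
      | some s =>
        convert M.measurableSet_cell s using 1
        change _ = M.cell s
        ext x
        rw [M.mem_cell_iff]
        by_cases hx : x ∈ sys.Xabs <;> simp [hx]

/-- The controller synthesized by pessimistic robust dynamic programming on a sound abstraction
achieves at least the computed lower bound, because the discretized kernel of each safe state is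
among the distributions over which the pessimistic operator minimizes. -/
theorem lowerBound_le_prob [Finite AP] [Finite U] [Nonempty U] [MeasurableSpace U]
    [DiscreteMeasurableSpace U] (hs : MeasurableSet sys.Xsafe) (h_lip : sys.LipschitzDynamics)
    (hrec : (sys.spec φ).RecognizedBy A) (hM : M.IsSound) {T : ℕ} {σ : Fin T → M.S → Z → U} (a₀ : U)
    (hσ : M.IsRDPStrategy A σ) (x₀ : X) :
    M.lowerBound A T x₀ ≤ sys.prob (M.refinedController A σ a₀) (sys.spec φ) x₀ := by
  have hV1 : ∀ k, ∀ x ∈ sys.Xsafe, ∀ z ∈ A.accept, M.pessValue A k x z = 1 :=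
    fun k x hx z hz => M.pessValue_of_accept hx hz k
  have hV01 : ∀ k x z, M.pessValue A k x z ∈ Set.Icc (0 : ℝ) 1 := M.pessValue_mem_Icc
  have hVm : ∀ k z, Measurable fun x => M.pessValue A k x z := M.measurable_pessValue hs
  have key := le_integral_closedLoop (M.refinedController A σ a₀) x₀ h_lip
    (Φ := fun t ω => sys.payoff A (sys.spec φ) (M.pessValue A (T - t)) ω)
    (fun t => measurable_payoff (hVm _) t) (fun t ω => payoff_mem_Icc (hV01 _) ω) fun t ω => ?_
  · rw [prob_eq_integral_payoff h_lip hrec]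
    simp only [Nat.sub_self, Nat.sub_zero] at key
    exact (payoff_init hrec (hV1 T) x₀).ge.trans key
  · have := h_lip.isProbabilityMeasure_kernel (ω.1 (Fin.last t))
      ((M.refinedController A σ a₀).act t ω)
    obtain ⟨k, hk⟩ : ∃ k, T - t = k + 1 := ⟨T - t - 1, by omega⟩
    have hk' : T - (t + 1) = k := by omega
    rw [hk, hk']
    by_cases h : sys.Satisfies ω (sys.spec φ)
    · simp only [payoff_extend_of_satisfies h]
      simp [payoff, h]
    · simp only [payoff_extend_of_not_satisfies hrec (hV1 k) h]
      rw [payoff, if_neg h]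
      set z := A.eval (sys.trace ω) with hzdef
      have hz : z ∉ A.accept :=
        mt (eval_mem_accept_iff hrec (trace_ne_nil ω)).1 (not_models_trace h)
      set x := ω.1 (Fin.last t) with hxdef
      by_cases hx : x ∈ sys.Xsafe
      · have hact : (M.refinedController A σ a₀).act t ω =
            σ t (M.ρ ⟨x, sys.safe_subset_abs hx⟩) z :=
          dif_pos (sys.safe_subset_abs hx)
        rw [hact] at this ⊢
        set s := M.ρ ⟨x, sys.safe_subset_abs hx⟩ with hsdef
        have hbest : M.pessValue A (k + 1) x z ≤
            M.pessAct A (M.pessValue A k) (σ t s z) s z := by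
          rw [pessValue, Function.iterate_succ_apply', pess, dif_pos hx]
          refine ciSup_le fun a => ?_
          have := hσ t s z a
          rwa [show T - t - 1 = k by omega] at this
        refine hbest.trans ?_
        rw [pessAct, if_neg hz]
        have hinf : sInf (M.expect A (M.pessValue A k) z '' M.Γ s (σ t s z)) ≤ M.expect A
            (M.pessValue A k) z fun s' => (sys.kernel x (σ t s z)).real (M.cell s') := by
          refine csInf_le ⟨0, ?_⟩ (Set.mem_image_of_mem _ (hM.1 x hx (σ t s z)))
          rintro _ ⟨γ, hγ, rfl⟩
          exact (M.expect_mem_Icc (hV01 k) A z (M.Γ_subset _ _ hγ)).1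
        refine hinf.trans (M.sum_kernel_cell_mul_le_integral h_lip hx
          (integrable_of_mem_Icc (measurable_comp_label (hVm k) _) fun _ => hV01 _ _ _)
          fun s' y hy => ?_)
        rw [M.label_of_mem_cell hy (M.rep_mem_cell s')]
        exact M.minorizer_le (hV01 k) hy _
      · have h0 : M.pessValue A (k + 1) x z = 0 := by
          rw [pessValue, Function.iterate_succ_apply', pess, dif_neg hx]
        rw [h0]
        exact integral_nonneg fun y => (hV01 _ _ _).1

end UMDP

end ControlSystem

theorem mainTheorem1 {n d : ℕ} {X : Set (EuclideanSpace ℝ (Fin n))}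
    {W : Set (EuclideanSpace ℝ (Fin d))} {U AP : Type*}
    [Finite U] [Nonempty U] [MeasurableSpace U] [DiscreteMeasurableSpace U] [Finite AP]
    (sys : ControlSystem X W U AP)
    (h_safe : sys.CompactSafeNullBoundary)
    (h_density : sys.BoundedDensity)
    (h_lip : sys.LipschitzDynamics)
    (Abs : ControlSystem.AbstractionProcedure sys)
    (h_amb : Tendsto (fun η : ℝ => (Abs.umdp η).ambiguityDiameter) (𝓝[>] (0 : ℝ)) (𝓝 0)) :
    Abs.AsymptoticallyOptimal := by
  intro φ T Z _ A hrec σ a₀ hσ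
  have hs := h_safe.1.measurableSet
  set V : X → ℝ := fun x₀ => sys.bellmanValue A T x₀ (A.step A.start (sys.L x₀)) with hV
  have hle : ∀ (κ : sys.Controller T) x₀, sys.prob κ (sys.spec φ) x₀ ≤ V x₀ := fun κ x₀ =>
    ControlSystem.prob_le_bellmanValue hs h_lip hrec κ x₀
  have hlow : ∀ η > 0, ∀ x₀, (Abs.umdp η).lowerBound A T x₀ ≤
      sys.prob ((Abs.umdp η).refinedController A (σ η) a₀) (sys.spec φ) x₀ := fun η hη x₀ =>
    (Abs.umdp η).lowerBound_le_prob hs h_lip hrec (Abs.sound η hη) a₀ (hσ η hη) x₀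
  have hclose : ∀ ε > 0, ∀ᶠ η in 𝓝[>] (0 : ℝ), 0 < η ∧ ∀ x₀,
      |(Abs.umdp η).lowerBound A T x₀ - V x₀| ≤ ε ∧
      |(Abs.umdp η).upperBound A T x₀ - V x₀| ≤ ε := by
    intro ε hε
    filter_upwards [Abs.eventually_abs_value_sub_le h_safe h_density h_lip h_amb A T hε,
      self_mem_nhdsWithin] with η h hη
    exact ⟨hη, fun x₀ => h x₀ _⟩
  -- The Bellman recursion gives the optimal probability: no controller exceeds it, and the
  -- synthesized controllers come arbitrarily close to it.
  have hopt : ∀ x₀, sys.optProb T (sys.spec φ) x₀ = V x₀ := by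
    intro x₀
    have : Nonempty (sys.Controller T) := ⟨(Abs.umdp 1).refinedController A (σ 1) a₀⟩
    have hbdd : BddAbove (Set.range fun κ : sys.Controller T => sys.prob κ (sys.spec φ) x₀) :=
      ⟨V x₀, by rintro _ ⟨κ, rfl⟩; exact hle κ x₀⟩
    refine le_antisymm (ciSup_le fun κ => hle κ x₀) (le_of_forall_pos_le_add fun ε hε => ?_)
    obtain ⟨η, hη, h⟩ := (hclose ε hε).exists
    have h1 := (abs_le.1 (h x₀).1).1
    have h2 := hlow η hη x₀
    have h3 := le_ciSup hbdd ((Abs.umdp η).refinedController A (σ η) a₀)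
    simp only [ControlSystem.optProb]
    linarith
  simp only [hopt, Metric.tendstoUniformly_iff, Real.dist_eq]
  refine ⟨fun ε hε => ?_, fun ε hε => ?_, fun ε hε => ?_⟩ <;>
    filter_upwards [hclose (ε / 2) (half_pos hε)] with η h x₀
  · have h1 := (abs_le.1 (h.2 x₀).1).1
    have h2 := hlow η h.1 x₀
    have h3 := hle ((Abs.umdp η).refinedController A (σ η) a₀) x₀
    rw [abs_lt]
    constructor <;> linarith
  · rw [abs_sub_comm]
    linarith [(h.2 x₀).1]
  · rw [abs_sub_comm]
    linarith [(h.2 x₀).2]
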